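/- Let $N\ge 2$ and let $\mathcal G_p,\mathcal G_c$ be undirected weighted graphs (with positive weights on their edges) on the vertex set $\{1,\dots,N\}$, with weighted Laplacians $\mathcal L_p,\mathcal L_c$; assume that $\mathcal G_c$ is connected. Let $A,A_p\in\mathbb R^{n\times n}$ and $B\in\mathbb R^{n\times 1}$, and for $K\in\mathbb R^{1\times n}$ consider the interconnected multi-agent system $$x(t+1)=\left(I_N\otimes A-\mathcal L_p\otimes A_p+\mathcal L_c\otimes BK\right)x(t),\qquad x=(x_1,\dots,x_N),\ x_i\in\mathbb R^n .$$ We say that $K$ achieves consensus if, for every initial condition, $\lim_{t\to\infty}|x_i(t)-\bar x(t)|=0$ for all $i$, where $\bar x(t)=\frac1N\sum_i x_i(t)$, and that the system is consensusable if some $K$ achieves consensus. Assume that $\mathcal L_p\mathcal L_c=\mathcal L_c\mathcal L_p$ and that $A_p=\alpha A$ for some $\alpha\in\mathbb R$. Then there is a real orthogonal matrix $\Phi$ with first column $\mathbf 1_N/\sqrt N$ such that $\Phi^\top\mathcal L_p\Phi=\mathrm{diag}(\lambda_{p,1},\dots,\lambda_{p,N})$ and $\Phi^\top\mathcal L_c\Phi=\mathrm{diag}(\lambda_{c,1},\dots,\lambda_{c,N})$;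 fix any such $\Phi$. Below $i$ and $j$ range over $\{2,\dots,N\}$. Assume that the pair $(A-\lambda_{p,i}A_p,B)$ is controllable for every $i$. Put $\alpha_i=1-\alpha\lambda_{p,i}$, $\alpha_{\max}=\max_i|\alpha_i|$, $\alpha_{\min}=\min_i|\alpha_i|$, $\lambda_{c,\max}=\max_j\lambda_{c,j}$, $\bar A=\alpha_{\max}A$, and $$\sigma_c=\begin{cases}1-\dfrac{1}{\prod_k|\lambda^u_k(\bar A)|^2},&\rho(\bar A)\ge 1,\\ 0,&\text{otherwise,}\end{cases}$$ where $\rho$ is the spectral radius and $\lambda^u_k(\bar A)$ are the eigenvalues of $\bar A$ of modulus at least $1$, counted with algebraic multiplicity. Suppose that $$\left(\frac{\max_{i,j}\frac{\alpha_i}{\lambda_{c,j}}-\min_{i,j}\frac{\alpha_i}{\lambda_{c,j}}}{2}\right)^2<\frac{\alpha_{\min}^2-\alpha_{\max}^2\sigma_c}{\lambda_{c,\max}^2}.$$ Then the system is consensusable. More precisely, let $$k=\tfrac12\left(\min_{i,j}\tfrac{\alpha_i}{\lambda_{c,j}}+\max_{i,j}\tfrac{\alpha_i}{\lambda_{c,j}}\right),\qquad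 \sigma_i=\frac{2\alpha_i\lambda_{c,i}k-\lambda_{c,i}^2k^2}{\alpha_{\max}^2}.$$ There is a symmetric positive definite matrix $P$ that satisfies, for all $i$ simultaneously, the modified algebraic Riccati inequality $$\bar A^\top P\bar A-\sigma_i\,\bar A^\top PB(B^\top PB)^{-1}B^\top P\bar A-P<0,$$ and for every such $P$ the gain $K=-k(B^\top PB)^{-1}B^\top PA$ achieves consensus. -/

import Mathlib

open Filter Topology
open scoped Matrix Kronecker

noncomputable section

namespace LIMAS

/-- An undirected weighted graph without loops: `weight i j > 0` on the edges, `0` elsewhere. -/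
structure WeightedGraph (V : Type*) where
  weight : V → V → ℝ
  symm : ∀ i j, weight i j = weight j i
  nonneg : ∀ i j, 0 ≤ weight i j
  loopless : ∀ i, weight i i = 0

namespace WeightedGraph

variable {V : Type*}

/-- The underlying simple graph; the edges are the pairs of positive weight. -/
def toSimpleGraph (G : WeightedGraph V) : SimpleGraph V where
  Adj i j := 0 < G.weight i j
  symm := ⟨fun i j h => by
    rw [G.symm j i]
    exact h⟩
  loopless := ⟨fun i h => by
    rw [G.loopless i] at h
    exact lt_irrefl 0 h⟩

/-- The weighted Laplacian: degrees on the diagonal minus the weights. -/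
def laplacian [Fintype V] [DecidableEq V] (G : WeightedGraph V) : Matrix V V ℝ :=
  Matrix.diagonal (fun i => ∑ j, G.weight i j) - Matrix.of G.weight

end WeightedGraph

/-- The closed-loop matrix `I_N ⊗ A - L_p ⊗ A_p + L_c ⊗ (B K)`. -/
def closedLoop {N n : ℕ} (Lp Lc : Matrix (Fin N) (Fin N) ℝ) (A Ap : Matrix (Fin n) (Fin n) ℝ)
    (B : Matrix (Fin n) (Fin 1) ℝ) (K : Matrix (Fin 1) (Fin n) ℝ) :
    Matrix (Fin N × Fin n) (Fin N × Fin n) ℝ :=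
  (1 : Matrix (Fin N) (Fin N) ℝ) ⊗ₖ A - Lp ⊗ₖ Ap + Lc ⊗ₖ (B * K)

/-- The average `(1/N) ∑ i, x_i` of the subsystem states. -/
def average {N n : ℕ} (x : Fin N × Fin n → ℝ) : Fin n → ℝ :=
  fun s => (1 / (N : ℝ)) * ∑ i, x (i, s)

/-- The gain `K` drives the states of all subsystems to their (time-varying) average, from every
initial condition. -/
def AchievesConsensus {N n : ℕ} (Lp Lc : Matrix (Fin N) (Fin N) ℝ)
    (A Ap : Matrix (Fin n) (Fin n) ℝ) (B : Matrix (Fin n) (Fin 1) ℝ)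
    (K : Matrix (Fin 1) (Fin n) ℝ) : Prop :=
  ∀ x : ℕ → (Fin N × Fin n → ℝ),
    (∀ t, x (t + 1) = closedLoop Lp Lc A Ap B K *ᵥ x t) →
    ∀ i : Fin N, Tendsto (fun t => (fun s => x t (i, s)) - average (x t)) atTop (𝓝 0)

/-- Existence of a static gain that achieves consensus. -/
def Consensusable {N n : ℕ} (Lp Lc : Matrix (Fin N) (Fin N) ℝ)
    (A Ap : Matrix (Fin n) (Fin n) ℝ) (B : Matrix (Fin n) (Fin 1) ℝ) : Prop :=
  ∃ K : Matrix (Fin 1) (Fin n) ℝ, AchievesConsensus Lp Lc A Ap B K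

/-- Controllability of the discrete-time system `x⁺ = A x + B u`: every state can be steered to
every state in finite time. -/
def IsControllable {n : ℕ} (A : Matrix (Fin n) (Fin n) ℝ) (B : Matrix (Fin n) (Fin 1) ℝ) : Prop :=
  ∀ x₀ x₁ : Fin n → ℝ, ∃ (T : ℕ) (u : ℕ → Fin 1 → ℝ) (x : ℕ → Fin n → ℝ),
    x 0 = x₀ ∧ (∀ t, x (t + 1) = A *ᵥ x t + B *ᵥ u t) ∧ x T = x₁

/-- `Φ` is orthogonal with first column `1_N / √N` and diagonalizes both Laplacians, with
eigenvalues `lamP i` and `lamC i` on the diagonals. -/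
structure IsModalBasis {N : ℕ} [NeZero N] (Lp Lc : Matrix (Fin N) (Fin N) ℝ)
    (Φ : Matrix (Fin N) (Fin N) ℝ) (lamP lamC : Fin N → ℝ) : Prop where
  orthogonal : Φᵀ * Φ = 1
  first_col : ∀ i, Φ i 0 = 1 / Real.sqrt N
  diag_p : Φᵀ * Lp * Φ = Matrix.diagonal lamP
  diag_c : Φᵀ * Lc * Φ = Matrix.diagonal lamC

/-- The indices of the modes other than the first one. -/
abbrev Mode (N : ℕ) [NeZero N] : Type := {i : Fin N // i ≠ 0}

section Quantities

variable {N : ℕ} [NeZero N]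

/-- `α_i = 1 - α λ_{p,i}`. -/
def alphaMode (α : ℝ) (lamP : Fin N → ℝ) (i : Mode N) : ℝ := 1 - α * lamP i

/-- `α_max = max_i |α_i|`. -/
def alphaMax (α : ℝ) (lamP : Fin N → ℝ) : ℝ := ⨆ i : Mode N, |alphaMode α lamP i|

/-- `α_min = min_i |α_i|`. -/
def alphaMin (α : ℝ) (lamP : Fin N → ℝ) : ℝ := ⨅ i : Mode N, |alphaMode α lamP i|

/-- `max_{i,j} α_i / λ_{c,j}`, with `i` and `j` ranging independently. -/
def ratioMax (α : ℝ) (lamP lamC : Fin N → ℝ) : ℝ :=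
  ⨆ p : Mode N × Mode N, alphaMode α lamP p.1 / lamC p.2

/-- `min_{i,j} α_i / λ_{c,j}`, with `i` and `j` ranging independently. -/
def ratioMin (α : ℝ) (lamP lamC : Fin N → ℝ) : ℝ :=
  ⨅ p : Mode N × Mode N, alphaMode α lamP p.1 / lamC p.2

/-- `λ_{c,max}`. -/
def lamMax (lamC : Fin N → ℝ) : ℝ := ⨆ j : Mode N, lamC j

/-- `k`, the midpoint of the extreme ratios. -/
def gainScalar (α : ℝ) (lamP lamC : Fin N → ℝ) : ℝ :=
  (ratioMin α lamP lamC + ratioMax α lamP lamC) / 2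

/-- `σ_i = (2 α_i λ_{c,i} k - λ_{c,i}² k²) / α_max²`. -/
def sigmaMode (α : ℝ) (lamP lamC : Fin N → ℝ) (i : Mode N) : ℝ :=
  (2 * alphaMode α lamP i * lamC i * gainScalar α lamP lamC
    - lamC i ^ 2 * gainScalar α lamP lamC ^ 2) / alphaMax α lamP ^ 2

end Quantities

/-- A real matrix regarded as a complex one. -/
def toComplex {n : ℕ} (M : Matrix (Fin n) (Fin n) ℝ) : Matrix (Fin n) (Fin n) ℂ :=
  M.map (fun r : ℝ => (r : ℂ))

open Classical in
/-- `σ_c` of a matrix: `1 - 1 / ∏ |λ|²` over the complex eigenvalues with `|λ| ≥ 1`, counted with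
algebraic multiplicity, if the spectral radius is at least one; `0` otherwise. -/
def sigmaCrit {n : ℕ} (M : Matrix (Fin n) (Fin n) ℝ) : ℝ :=
  if 1 ≤ spectralRadius ℂ (toComplex M) then
    1 - 1 / (((toComplex M).charpoly.roots.filter (fun z : ℂ => 1 ≤ ‖z‖)).map
      (fun z : ℂ => ‖z‖ ^ 2)).prod
  else 0

/-- The modified algebraic Riccati inequality
`Mᵀ P M - σ Mᵀ P B (Bᵀ P B)⁻¹ Bᵀ P M - P < 0`. -/
def RiccatiIneq {n : ℕ} (M : Matrix (Fin n) (Fin n) ℝ) (B : Matrix (Fin n) (Fin 1) ℝ) (σ : ℝ)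
    (P : Matrix (Fin n) (Fin n) ℝ) : Prop :=
  (-(Mᵀ * P * M - σ • (Mᵀ * P * B * (Bᵀ * P * B)⁻¹ * Bᵀ * P * M) - P)).PosDef

/-- `K = -k (Bᵀ P B)⁻¹ Bᵀ P A`. -/
def riccatiGain {n : ℕ} (A : Matrix (Fin n) (Fin n) ℝ) (B : Matrix (Fin n) (Fin 1) ℝ) (k : ℝ)
    (P : Matrix (Fin n) (Fin n) ℝ) : Matrix (Fin 1) (Fin n) ℝ :=
  -(k • ((Bᵀ * P * B)⁻¹ * Bᵀ * P * A))

end LIMAS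

end

/-!
In the modal coordinates `z_i = ∑ a, Φ a i • x_a` the closed loop splits into the systems
`z_i⁺ = (α_i A + λ_{c,i} B K) z_i`, and `x_a` minus the average is a combination of the `z_i` with
`i ≠ 0`. Consensus therefore means that all these modes are stable
(`achievesConsensus_of_tendsto_modes`). For the Riccati gain the form of `P` decreases strictly
along the `i`-th mode: this is the Riccati inequality with parameter `σ_i`, up to
`α_i ^ 2 ≤ α_max ^ 2` (`energy_mode_lt`).

The remaining point is a common `P`. The gap condition says `σ_c < σ_i` for all `i`
(`lt_sigmaMode`), and the inequality gets weaker as `σ` grows, so it suffices to treat one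
`σ > σ_c` (`exists_posDef_riccatiIneq`). Put `g = Bᵀ P B`. If `g / (1 + g) ≤ σ`, the inequality
follows from its "minimum energy" version: for all `x ≠ 0` there is an input `u` with
`P(M x + B u) + u² < P(x)`. Hence one needs a strict control Lyapunov form `P` with `1 + g` as close
as desired to the product of `|λ|²` over the unstable eigenvalues `λ` of `M`.

Over `ℂ` such a `P` is built by induction on the number of unstable eigenvalues
(`exists_posDef_energy_add_lt`), for the cost `R |u|²`. Let `w` be a left eigenvector for an
unstable `λ`; controllability gives `w b ≠ 0`. With `P = P₂ + p w* w`, completing the square in `u`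
turns the problem for `P` into the same problem for `P₂`, for the matrix `M + b k w` and the cost
`R' = R + p |w b|²`. The feedback `k` that appears replaces the eigenvalue `λ` by `c / conj λ`, and
`R' = R |λ|² / c`, where `c < 1` is arbitrary. When no unstable eigenvalue is left, a small multiple
of a Lyapunov form works.

To return to `ℝ`, pass to `Q = P⁻¹`: there the two requirements become the linear matrix
inequalities `M Q M* < Q + b b*` and `b b* ≤ g Q`, which for real `M` and `b` are inherited by the
real part of `Q`; then invert again (`exists_posDef_energy_add_lt_real`).
-/

namespace LIMAS

/-! ### Quadratic forms -/

section Energy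

open scoped ComplexOrder

variable {𝕜 : Type*} [RCLike 𝕜] {m : Type*} [Fintype m]

/-- The value `x* P x` of the Hermitian form of `P`, as a real number. -/
noncomputable def energy (P : Matrix m m 𝕜) (x : m → 𝕜) : ℝ := RCLike.re (star x ⬝ᵥ (P *ᵥ x))

theorem energy_real (P : Matrix m m ℝ) (x : m → ℝ) : energy P x = x ⬝ᵥ (P *ᵥ x) := by
  simp [energy]

theorem energy_add (P Q : Matrix m m 𝕜) (x : m → 𝕜) :
    energy (P + Q) x = energy P x + energy Q x := by
  simp [energy, Matrix.add_mulVec, dotProduct_add]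

theorem energy_sub (P Q : Matrix m m 𝕜) (x : m → 𝕜) :
    energy (P - Q) x = energy P x - energy Q x := by
  simp [energy, Matrix.sub_mulVec, dotProduct_sub]

theorem energy_sum {ι : Type*} (s : Finset ι) (P : ι → Matrix m m 𝕜) (x : m → 𝕜) :
    energy (∑ i ∈ s, P i) x = ∑ i ∈ s, energy (P i) x := by
  simp [energy, Matrix.sum_mulVec, dotProduct_sum]

theorem energy_smul (r : ℝ) (P : Matrix m m 𝕜) (x : m → 𝕜) :
    energy (r • P) x = r * energy P x := by
  simp [energy, Matrix.smul_mulVec, dotProduct_smul, RCLike.smul_re]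

theorem energy_conjTranspose_mul_mul (P M : Matrix m m 𝕜) (x : m → 𝕜) :
    energy (Mᴴ * P * M) x = energy P (M *ᵥ x) := by
  simp [energy, Matrix.star_mulVec, Matrix.dotProduct_mulVec, Matrix.vecMul_vecMul, mul_assoc]

theorem energy_vecMulVec (w x : m → 𝕜) :
    energy (Matrix.vecMulVec (star w) w) x = ‖w ⬝ᵥ x‖ ^ 2 := by
  have h : star x ⬝ᵥ (Matrix.vecMulVec (star w) w *ᵥ x) = star (w ⬝ᵥ x) * (w ⬝ᵥ x) := by
    rw [Matrix.vecMulVec_mulVec, Matrix.star_dotProduct, dotProduct_comm]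
    simp [dotProduct_smul, mul_comm, dotProduct_comm]
  rw [energy, h, RCLike.star_def, RCLike.conj_mul]
  norm_cast

theorem posDef_iff_energy {P : Matrix m m 𝕜} :
    P.PosDef ↔ P.IsHermitian ∧ ∀ x ≠ 0, 0 < energy P x := by
  rw [Matrix.posDef_iff_dotProduct_mulVec]
  refine and_congr_right fun hP => forall₂_congr fun x _ => ?_
  rw [RCLike.pos_iff, energy]
  exact and_iff_left (hP.im_star_dotProduct_mulVec_self x)

theorem energy_nonneg {P : Matrix m m 𝕜} (hP : P.PosDef) (x : m → 𝕜) : 0 ≤ energy P x :=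
  hP.posSemidef.re_dotProduct_nonneg x

/-- The arithmetic-geometric form of the Cauchy-Schwarz inequality between the norms of `P` and of
`P⁻¹`. -/
theorem two_mul_re_dotProduct_le [DecidableEq m] {P : Matrix m m 𝕜} (hP : P.PosDef)
    (x y : m → 𝕜) :
    2 * RCLike.re (star y ⬝ᵥ x) ≤ energy P⁻¹ y + energy P x := by
  have hu : IsUnit P.det := (Matrix.isUnit_iff_isUnit_det _).1 hP.isUnit
  have h := energy_nonneg hP (x - P⁻¹ *ᵥ y)
  have h1 : P *ᵥ (P⁻¹ *ᵥ y) = y := by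
    rw [Matrix.mulVec_mulVec, Matrix.mul_nonsing_inv _ hu, Matrix.one_mulVec]
  have h2 : star (P⁻¹ *ᵥ y) ⬝ᵥ (P *ᵥ x) = star y ⬝ᵥ x := by
    rw [Matrix.star_mulVec, hP.inv.isHermitian.eq, Matrix.dotProduct_mulVec, Matrix.vecMul_vecMul,
      Matrix.nonsing_inv_mul _ hu, Matrix.vecMul_one]
  have h3 : RCLike.re (star x ⬝ᵥ y) = RCLike.re (star y ⬝ᵥ x) := by
    rw [Matrix.star_dotProduct, RCLike.star_def, RCLike.conj_re]
  have h4 : RCLike.re (star (P⁻¹ *ᵥ y) ⬝ᵥ y) = RCLike.re (star y ⬝ᵥ (P⁻¹ *ᵥ y)) := by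
    rw [Matrix.star_mulVec, hP.inv.isHermitian.eq, Matrix.dotProduct_mulVec]
  simp only [energy, Matrix.mulVec_sub, star_sub, sub_dotProduct, dotProduct_sub, h1, h2, map_sub,
    h3, h4] at h ⊢
  linarith

end Energy

/-! ### Stable matrices -/

section Stable

open scoped ComplexOrder

open scoped Matrix.Norms.L2Operator in
/-- By Gelfand's formula, some power of a matrix with all eigenvalues in the open unit disc is a
strict contraction for the Euclidean norm. -/
theorem exists_energy_one_pow_lt {n : ℕ} {M : Matrix (Fin n) (Fin n) ℂ}
    (h : ∀ z ∈ M.charpoly.roots, ‖z‖ < 1) :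
    ∃ m : ℕ, m ≠ 0 ∧ ∀ x ≠ 0, energy (1 : Matrix (Fin n) (Fin n) ℂ) (M ^ m *ᵥ x) < energy 1 x := by
  rcases n.eq_zero_or_pos with rfl | hn
  · exact ⟨1, one_ne_zero, fun x hx => (hx (Subsingleton.elim _ _)).elim⟩
  have : Nonempty (Fin n) := ⟨⟨0, hn⟩⟩
  have : CompleteSpace (Matrix (Fin n) (Fin n) ℂ) := FiniteDimensional.complete ℂ _
  have hr : spectralRadius ℂ M < 1 := by
    refine spectrum.spectralRadius_lt_of_forall_lt M (r := 1) fun z hz => ?_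
    rw [← NNReal.coe_lt_coe]
    exact h z ((Polynomial.mem_roots M.charpoly_monic.ne_zero).2
      (Matrix.mem_spectrum_iff_isRoot_charpoly.1 hz))
  obtain ⟨m, hm1, hm⟩ := ((Filter.eventually_ge_atTop 1).and
    ((spectrum.pow_nnnorm_pow_one_div_tendsto_nhds_spectralRadius M).eventually_lt_const hr)).exists
  have hlt : ‖M ^ m‖ < 1 := by
    by_contra! hle
    refine hm.not_ge (ENNReal.one_le_rpow ?_ (by positivity))
    exact_mod_cast hle
  refine ⟨m, by omega, fun x hx => ?_⟩
  have hone : ∀ y : Fin n → ℂ, energy (1 : Matrix (Fin n) (Fin n) ℂ) y =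
      ‖(WithLp.toLp 2 y : EuclideanSpace ℂ (Fin n))‖ ^ 2 := fun y => by
    rw [EuclideanSpace.norm_sq_eq, energy, Matrix.one_mulVec]
    simp [dotProduct, Complex.conj_mul', ← Complex.ofReal_pow]
  rw [hone, hone]
  have hx' : 0 < ‖(WithLp.toLp 2 x : EuclideanSpace ℂ (Fin n))‖ := by simpa using hx
  gcongr
  exact (Matrix.l2_opNorm_mulVec (M ^ m) (WithLp.toLp 2 x)).trans_lt
    (mul_lt_of_lt_one_left hx' hlt)

/-- The discrete Lyapunov theorem. The form is the finite sum of `|M ^ j x|²` over `j < m`, where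
`M ^ m` is a strict contraction; it telescopes along `M`. -/
theorem exists_posDef_energy_lt {n : ℕ} {M : Matrix (Fin n) (Fin n) ℂ}
    (h : ∀ z ∈ M.charpoly.roots, ‖z‖ < 1) :
    ∃ S : Matrix (Fin n) (Fin n) ℂ, S.PosDef ∧ ∀ x ≠ 0, energy S (M *ᵥ x) < energy S x := by
  obtain ⟨m, hm, hlt⟩ := exists_energy_one_pow_lt h
  have hS : ∀ x, energy (∑ j ∈ Finset.range m, (M ^ j)ᴴ * 1 * M ^ j) x =
      ∑ j ∈ Finset.range m, energy (1 : Matrix (Fin n) (Fin n) ℂ) (M ^ j *ᵥ x) := fun x => by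
    simp_rw [energy_sum, energy_conjTranspose_mul_mul]
  refine ⟨∑ j ∈ Finset.range m, (M ^ j)ᴴ * 1 * M ^ j, posDef_iff_energy.2 ⟨?_, fun x hx => ?_⟩,
    fun x hx => ?_⟩
  · simp [Matrix.IsHermitian, Matrix.conjTranspose_sum]
  · rw [hS]
    obtain ⟨m, rfl⟩ := Nat.exists_eq_succ_of_ne_zero hm
    rw [Finset.sum_range_succ']
    have h1 : 0 < energy (1 : Matrix (Fin n) (Fin n) ℂ) x :=
      (posDef_iff_energy.1 Matrix.PosDef.one).2 x hx
    have h2 : 0 ≤ ∑ j ∈ Finset.range m,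
        energy (1 : Matrix (Fin n) (Fin n) ℂ) (M ^ (j + 1) *ᵥ x) :=
      Finset.sum_nonneg fun j _ => energy_nonneg Matrix.PosDef.one _
    simpa using add_pos_of_nonneg_of_pos h2 h1
  · rw [hS, hS, ← sub_neg, ← Finset.sum_sub_distrib]
    have h1 : ∀ j, energy (1 : Matrix (Fin n) (Fin n) ℂ) (M ^ j *ᵥ (M *ᵥ x)) =
        energy (1 : Matrix (Fin n) (Fin n) ℂ) (M ^ (j + 1) *ᵥ x) := fun j => by
      rw [Matrix.mulVec_mulVec, pow_succ]
    simp_rw [h1]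
    rw [Finset.sum_range_sub fun j => energy (1 : Matrix (Fin n) (Fin n) ℂ) (M ^ j *ᵥ x)]
    simpa using hlt x hx

end Stable

/-! ### Moving one eigenvalue by rank-one feedback -/

/-- Feedback through a left eigenvector `w` moves the eigenvalue of `w` and keeps the other ones. -/
theorem charpoly_add_vecMulVec {n : ℕ} {A : Matrix (Fin n) (Fin n) ℂ} {w : Fin n → ℂ} {l : ℂ}
    (hw : w ᵥ* A = l • w) (b : Fin n → ℂ) :
    (Polynomial.X - Polynomial.C l) * (A + Matrix.vecMulVec b w).charpoly =
      (Polynomial.X - Polynomial.C (l + w ⬝ᵥ b)) * A.charpoly := by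
  -- away from `l` the left eigenvector allows to factor `z - A - b w`, without inverting `z - A`
  refine Polynomial.eq_of_infinite_eval_eq _ _ ((Set.finite_singleton l).infinite_compl.mono ?_)
  intro z hz
  have hz : z - l ≠ 0 := sub_ne_zero.2 hz
  have key : Matrix.scalar (Fin n) z - (A + Matrix.vecMulVec b w) =
      (1 - Matrix.replicateCol Unit ((z - l)⁻¹ • b) * Matrix.replicateRow Unit w) *
        (Matrix.scalar (Fin n) z - A) := by
    have h1 : w ᵥ* (Matrix.scalar (Fin n) z - A) = (z - l) • w := by
      rw [Matrix.vecMul_sub, hw, sub_smul]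
      congr 1
      ext i
      simp [mul_comm]
    rw [sub_mul, one_mul, ← Matrix.vecMulVec_eq, Matrix.vecMulVec_mul, h1,
      Matrix.vecMulVec_smul, Matrix.smul_vecMulVec, smul_smul, mul_inv_cancel₀ hz, one_smul]
    abel
  simp only [Set.mem_ofPred_eq, Polynomial.eval_mul, Polynomial.eval_sub, Polynomial.eval_X,
    Polynomial.eval_C, Matrix.eval_charpoly]
  rw [key, Matrix.det_mul, Matrix.det_one_sub_mul_comm]
  simp
  field_simp
  ring

/-! ### The Riccati inequality over the complex numbers -/

section Riccati

open scoped ComplexOrder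

open Classical in
/-- The eigenvalues of modulus at least one, counted with algebraic multiplicity. -/
noncomputable def unstableRoots {n : ℕ} (A : Matrix (Fin n) (Fin n) ℂ) : Multiset ℂ :=
  A.charpoly.roots.filter fun z : ℂ => 1 ≤ ‖z‖

theorem unstableRoots_add_vecMulVec {n : ℕ} {A : Matrix (Fin n) (Fin n) ℂ} {w : Fin n → ℂ} {l : ℂ}
    (hw : w ᵥ* A = l • w) (hl : 1 ≤ ‖l‖) {b : Fin n → ℂ} (hb : ‖l + w ⬝ᵥ b‖ < 1) :
    l ::ₘ unstableRoots (A + Matrix.vecMulVec b w) = unstableRoots A := by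
  have h := congrArg Polynomial.roots (charpoly_add_vecMulVec hw b)
  rw [Polynomial.roots_mul (mul_ne_zero (Polynomial.X_sub_C_ne_zero _)
      (Matrix.charpoly_monic _).ne_zero),
    Polynomial.roots_mul (mul_ne_zero (Polynomial.X_sub_C_ne_zero _)
      (Matrix.charpoly_monic _).ne_zero),
    Polynomial.roots_X_sub_C, Polynomial.roots_X_sub_C, Multiset.singleton_add,
    Multiset.singleton_add] at h
  have h' := congrArg (Multiset.filter fun z : ℂ => 1 ≤ ‖z‖) h
  rwa [Multiset.filter_cons_of_pos (p := fun z : ℂ => 1 ≤ ‖z‖) _ hl,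
    Multiset.filter_cons_of_neg (p := fun z : ℂ => 1 ≤ ‖z‖) _ hb.not_ge] at h'

theorem one_le_prod_unstableRoots {n : ℕ} (A : Matrix (Fin n) (Fin n) ℂ) :
    1 ≤ ((unstableRoots A).map fun z : ℂ => ‖z‖ ^ 2).prod := by
  refine Multiset.one_le_prod fun r hr => ?_
  obtain ⟨z, hz, rfl⟩ := Multiset.mem_map.1 hr
  exact one_le_pow₀ (Multiset.mem_filter.1 hz).2

/-- The Popov-Belevitch-Hautus condition for a pair with scalar input: no left eigenvector of `A`
is orthogonal to the input vector `b`. -/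
def IsHautus {n : ℕ} (A : Matrix (Fin n) (Fin n) ℂ) (b : Fin n → ℂ) : Prop :=
  ∀ (w : Fin n → ℂ) (l : ℂ), w ≠ 0 → w ᵥ* A = l • w → w ⬝ᵥ b ≠ 0

/-- State feedback preserves the Hautus condition. -/
theorem IsHautus.add_vecMulVec {n : ℕ} {A : Matrix (Fin n) (Fin n) ℂ} {b : Fin n → ℂ}
    (h : IsHautus A b) (f : Fin n → ℂ) : IsHautus (A + Matrix.vecMulVec b f) b := by
  intro w l hw hwA hwb
  refine h w l hw ?_ hwb
  rwa [Matrix.vecMul_add, Matrix.vecMul_vecMulVec, hwb, zero_smul, add_zero] at hwA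

/-- Completing the square in the scalar problem `p |l s + β u|² + R |u|²`: its minimum over `u` is
attained at `u = k s`. -/
theorem norm_sq_add_le {l β s u v k : ℂ} {p R R' c : ℝ} (hR' : R' = R + p * ‖β‖ ^ 2)
    (hlR : R' * c = R * ‖l‖ ^ 2) (hpos : 0 < R') (hk : k = -(p * star β * l / R'))
    (hu : u = k * s + v) :
    p * ‖l * s + β * u‖ ^ 2 + R * ‖u‖ ^ 2 = p * c * ‖s‖ ^ 2 + R' * ‖v‖ ^ 2 := by
  have hne : (R' : ℂ) ≠ 0 := by exact_mod_cast hpos.ne'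
  have hns : ∀ z : ℂ, ((‖z‖ ^ 2 : ℝ) : ℂ) = z * star z := fun z => by
    rw [Complex.star_def, Complex.mul_conj']; push_cast; rfl
  have h1 : (R' : ℂ) = R + p * (β * star β) := by rw [hR', ← hns]; push_cast; rfl
  have h2 : (R' : ℂ) * c = R * (l * star l) := by rw [← hns]; exact_mod_cast hlR
  have hc : (c : ℂ) = R * (l * star l) / R' := by field_simp; linear_combination h2
  rw [← Complex.ofReal_inj]
  push_cast [Complex.ofReal_add, Complex.ofReal_mul, hns]
  subst hu
  have hk' : star k = -(p * β * star l / R') := by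
    simp [hk, Complex.conj_ofReal]
  have hR1 : (R : ℂ) = R' - p * (β * star β) := by rw [h1]; ring
  simp only [star_add, star_mul', hk', hc]
  rw [hk, hR1]
  field_simp
  ring

/-- A control Lyapunov form for the input cost `R |u|²` whose value at the input vector `b` exceeds
`R (∏ |λ|² - 1)` by as little as desired, the product running over the unstable eigenvalues. -/
theorem exists_posDef_energy_add_lt {n : ℕ} {A : Matrix (Fin n) (Fin n) ℂ} {b : Fin n → ℂ}
    (hAb : IsHautus A b) {R G : ℝ} (hR : 0 < R)
    (hG : R * ((unstableRoots A).map fun z : ℂ => ‖z‖ ^ 2).prod < G) :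
    ∃ P : Matrix (Fin n) (Fin n) ℂ, P.PosDef ∧
      (∀ x ≠ 0, ∃ u : ℂ, energy P (A *ᵥ x + u • b) + R * ‖u‖ ^ 2 < energy P x) ∧
      R + energy P b < G := by
  induction hm : (unstableRoots A).card generalizing A R with
  | zero =>
    have h0 : unstableRoots A = 0 := Multiset.card_eq_zero.1 hm
    obtain ⟨S, hS, hlt⟩ := exists_posDef_energy_lt (M := A) fun z hz => by
      by_contra! hle
      have : z ∈ unstableRoots A := Multiset.mem_filter.2 ⟨hz, hle⟩
      simp [h0] at this
    have hRG : 0 < G - R := by simpa [h0] using hG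
    have hSb := energy_nonneg hS b
    -- the scale is chosen so that the form of `b` stays below `G - R`
    set ε : ℝ := (G - R) / (energy S b + 1)
    have hε : 0 < ε := by positivity
    have hεb : ε * energy S b < G - R := by
      rw [div_mul_eq_mul_div, div_lt_iff₀ (by positivity)]
      nlinarith
    refine ⟨ε • S, posDef_iff_energy.2 ⟨?_, fun x hx => ?_⟩, fun x hx => ⟨0, ?_⟩, ?_⟩
    · rw [Matrix.IsHermitian, Matrix.conjTranspose_smul, hS.isHermitian.eq]
      simp
    · exact (energy_smul ε S x).symm ▸ mul_pos hε ((posDef_iff_energy.1 hS).2 x hx)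
    · simpa [energy_smul] using mul_lt_mul_of_pos_left (hlt x hx) hε
    · rw [energy_smul]
      linarith
  | succ m ih =>
    obtain ⟨l, hl⟩ : ∃ l, l ∈ unstableRoots A := Multiset.card_pos_iff_exists_mem.1 (hm.symm ▸ m.succ_pos)
    obtain ⟨hroot, hl1⟩ := Multiset.mem_filter.1 hl
    obtain ⟨w, hw0, hw⟩ : ∃ w ≠ 0, w ᵥ* A = l • w := by
      have hdet := (Polynomial.mem_roots A.charpoly_monic.ne_zero).1 hroot
      rw [Polynomial.IsRoot, Matrix.eval_charpoly, ← Matrix.exists_vecMul_eq_zero_iff] at hdet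
      obtain ⟨w, hw0, hw⟩ := hdet
      refine ⟨w, hw0, ?_⟩
      rw [Matrix.vecMul_sub, sub_eq_zero] at hw
      rw [← hw]
      ext i
      simp [mul_comm]
    set β := w ⬝ᵥ b with hβ
    have hβ0 : 0 < ‖β‖ := norm_pos_iff.2 (hAb w l hw0 hw)
    set q := ((unstableRoots A).map fun z : ℂ => ‖z‖ ^ 2).prod with hq
    have hq1 : 1 ≤ q := one_le_prod_unstableRoots A
    have hq0 : 0 < q := by linarith
    have hG0 : 0 < G := (by positivity : 0 < R * q).trans hG
    -- the slack in `hG` allows to shrink the reflected eigenvalue by a factor `c < 1`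
    obtain ⟨c, hc1, hc2⟩ := exists_between ((div_lt_one hG0).2 hG)
    have hc0 : 0 < c := (by positivity : 0 < R * q / G).trans hc1
    have hl2 : 1 ≤ ‖l‖ ^ 2 := one_le_pow₀ hl1
    set R' := R * ‖l‖ ^ 2 / c with hR'
    have hRR' : R < R' := by
      rw [hR', lt_div_iff₀ hc0]
      nlinarith
    have hR'0 : 0 < R' := hR.trans hRR'
    set p := (R' - R) / ‖β‖ ^ 2 with hp
    have hp0 : 0 < p := div_pos (sub_pos.2 hRR') (by positivity)
    have hpβ : R' = R + p * ‖β‖ ^ 2 := by rw [hp]; field_simp; ring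
    have hlR : R' * c = R * ‖l‖ ^ 2 := by rw [hR']; field_simp
    set k : ℂ := -(p * star β * l / R') with hk
    have hne : (R' : ℂ) ≠ 0 := by exact_mod_cast hR'0.ne'
    have hnew : l + w ⬝ᵥ (k • b) = l * (R / R' : ℝ) := by
      have hns : β * star β = ((‖β‖ ^ 2 : ℝ) : ℂ) := by
        rw [Complex.star_def, Complex.mul_conj']; push_cast; rfl
      have : (R' : ℂ) = R + p * (β * star β) := by rw [hns, hpβ]; push_cast; rfl
      rw [dotProduct_smul, ← hβ, hk, smul_eq_mul]
      push_cast
      field_simp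
      rw [this]
      ring
    have hsmall : ‖l + w ⬝ᵥ (k • b)‖ < 1 := by
      have h2 : ‖l‖ * (R / R') = c / ‖l‖ := by
        rw [hR']
        have : ‖l‖ ≠ 0 := by positivity
        field_simp
      rw [hnew, norm_mul, Complex.norm_real, Real.norm_of_nonneg (by positivity), h2,
        div_lt_one (by positivity)]
      linarith
    have hcons := unstableRoots_add_vecMulVec hw hl1 hsmall
    rw [Matrix.smul_vecMulVec, ← Matrix.vecMulVec_smul] at hcons
    obtain ⟨P, hP, hlt, hPb⟩ := ih (A := A + Matrix.vecMulVec b (k • w)) (R := R')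
      (hAb.add_vecMulVec _) hR'0 (by
        have h3 : q = ‖l‖ ^ 2 * ((unstableRoots (A + Matrix.vecMulVec b (k • w))).map
            fun z : ℂ => ‖z‖ ^ 2).prod := by
          rw [hq, ← hcons, Multiset.map_cons, Multiset.prod_cons]
        rw [div_lt_iff₀ hG0, h3] at hc1
        rw [hR', div_mul_eq_mul_div, div_lt_iff₀ hc0]
        linarith) (by
        rw [← hcons, Multiset.card_cons] at hm
        omega)
    have henergy : ∀ y, energy (P + p • Matrix.vecMulVec (star w) w) y =
        energy P y + p * ‖w ⬝ᵥ y‖ ^ 2 := fun y => by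
      rw [energy_add, energy_smul, energy_vecMulVec]
    refine ⟨P + p • Matrix.vecMulVec (star w) w, posDef_iff_energy.2 ⟨?_, fun x hx => ?_⟩,
      fun x hx => ?_, ?_⟩
    · refine hP.isHermitian.add ?_
      rw [Matrix.IsHermitian, Matrix.conjTranspose_smul, Matrix.conjTranspose_vecMulVec]
      simp
    · rw [henergy]
      have := (posDef_iff_energy.1 hP).2 x hx
      positivity
    · obtain ⟨v, hv⟩ := hlt x hx
      refine ⟨k * (w ⬝ᵥ x) + v, ?_⟩
      have hx1 : A *ᵥ x + (k * (w ⬝ᵥ x) + v) • b =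
          (A + Matrix.vecMulVec b (k • w)) *ᵥ x + v • b := by
        rw [Matrix.add_mulVec, Matrix.vecMulVec_mulVec, op_smul_eq_smul, smul_dotProduct,
          smul_eq_mul, add_smul, add_assoc]
      have hx2 : w ⬝ᵥ (A *ᵥ x + (k * (w ⬝ᵥ x) + v) • b) =
          l * (w ⬝ᵥ x) + β * (k * (w ⬝ᵥ x) + v) := by
        rw [dotProduct_add, Matrix.dotProduct_mulVec, hw, smul_dotProduct, dotProduct_smul, ← hβ,
          smul_eq_mul, smul_eq_mul, mul_comm β]
      have hsq := norm_sq_add_le (s := w ⬝ᵥ x) (v := v) hpβ hlR hR'0 hk rfl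
      rw [henergy, henergy, hx2, hx1]
      have : p * c * ‖w ⬝ᵥ x‖ ^ 2 ≤ p * ‖w ⬝ᵥ x‖ ^ 2 := by
        gcongr
        nlinarith
      linarith
    · rw [henergy, ← hβ]
      linarith

end Riccati

/-! ### Descent to the real numbers -/

section Descent

open scoped ComplexOrder

variable {n : ℕ}

/-- The control Lyapunov inequality for `P` implies the matrix inequality `A Q A* < Q + b b*` for
`Q = P⁻¹`, which is linear in `Q`. -/
theorem energy_inv_conjTranspose_lt {P A : Matrix (Fin n) (Fin n) ℂ} {b : Fin n → ℂ}
    (hP : P.PosDef)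
    (h : ∀ x ≠ 0, ∃ u : ℂ, energy P (A *ᵥ x + u • b) + ‖u‖ ^ 2 < energy P x)
    {y : Fin n → ℂ} (hy : y ≠ 0) :
    energy P⁻¹ (Aᴴ *ᵥ y) < energy P⁻¹ y + ‖star y ⬝ᵥ b‖ ^ 2 := by
  have hu : IsUnit P.det := (Matrix.isUnit_iff_isUnit_det _).1 hP.isUnit
  have hpos : 0 < energy P⁻¹ y := (posDef_iff_energy.1 hP.inv).2 y hy
  obtain ⟨x, hx⟩ : ∃ x, x = P⁻¹ *ᵥ (Aᴴ *ᵥ y) := ⟨_, rfl⟩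
  have hPx : P *ᵥ x = Aᴴ *ᵥ y := by
    rw [hx, Matrix.mulVec_mulVec, Matrix.mul_nonsing_inv _ hu, Matrix.one_mulVec]
  rcases eq_or_ne x 0 with h0 | h0
  · rw [← hPx, h0, Matrix.mulVec_zero]
    have : energy P⁻¹ (0 : Fin n → ℂ) = 0 := by simp [energy]
    rw [this]
    positivity
  obtain ⟨u, hlt⟩ := h x h0
  have hL : energy P⁻¹ (Aᴴ *ᵥ y) = RCLike.re (star y ⬝ᵥ (A *ᵥ x)) := by
    rw [energy, ← hx, Matrix.star_mulVec, Matrix.conjTranspose_conjTranspose,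
      ← Matrix.dotProduct_mulVec]
  have hL' : energy P x = RCLike.re (star y ⬝ᵥ (A *ᵥ x)) := by
    rw [energy, hPx, Matrix.dotProduct_mulVec, ← Matrix.star_mulVec, Matrix.star_dotProduct,
      RCLike.star_def, RCLike.conj_re]
  have h1 := two_mul_re_dotProduct_le hP (A *ᵥ x + u • b) y
  have h2 : RCLike.re (star y ⬝ᵥ (A *ᵥ x + u • b)) =
      RCLike.re (star y ⬝ᵥ (A *ᵥ x)) + (u * (star y ⬝ᵥ b)).re := by
    simp [dotProduct_add, dotProduct_smul]
  have h3 : -(u * (star y ⬝ᵥ b)).re ≤ ‖u‖ * ‖star y ⬝ᵥ b‖ := by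
    rw [← norm_mul]
    exact (neg_le_abs _).trans (Complex.abs_re_le_norm _)
  nlinarith [sq_nonneg (‖u‖ - ‖star y ⬝ᵥ b‖)]

/-- The bound `b* P b ≤ g` implies the matrix inequality `b b* ≤ g P⁻¹`. -/
theorem norm_dotProduct_sq_le_mul_energy_inv {P : Matrix (Fin n) (Fin n) ℂ} {b : Fin n → ℂ}
    (hP : P.PosDef) {g : ℝ} (hg : 0 < g) (hb : energy P b ≤ g) (y : Fin n → ℂ) :
    ‖star y ⬝ᵥ b‖ ^ 2 ≤ g * energy P⁻¹ y := by
  set β := star y ⬝ᵥ b with hβ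
  -- the vector `(conj β / g) b` is optimal in the arithmetic-geometric inequality if `b* P b = g`
  have h1 := two_mul_re_dotProduct_le hP ((star β / g) • b) y
  have h2 : RCLike.re (star y ⬝ᵥ ((star β / g) • b)) = ‖β‖ ^ 2 / g := by
    rw [dotProduct_smul, ← hβ, smul_eq_mul, div_mul_eq_mul_div, Complex.star_def,
      Complex.conj_mul']
    norm_cast
  have h3 : energy P ((star β / g) • b) = (‖β‖ ^ 2 / g ^ 2) * energy P b := by
    have : star ((star β / g) • b) ⬝ᵥ (P *ᵥ ((star β / g) • b)) =
        ((‖β‖ ^ 2 / g ^ 2 : ℝ) : ℂ) * (star b ⬝ᵥ (P *ᵥ b)) := by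
      rw [Matrix.mulVec_smul, star_smul, smul_dotProduct, dotProduct_smul, smul_eq_mul,
        smul_eq_mul, ← mul_assoc]
      congr 1
      push_cast
      rw [← Complex.mul_conj']
      simp
      field_simp
    rw [energy, this]
    exact Complex.re_ofReal_mul _ _
  have h4 : ‖β‖ ^ 2 / g ^ 2 * energy P b ≤ ‖β‖ ^ 2 / g := by
    calc ‖β‖ ^ 2 / g ^ 2 * energy P b ≤ ‖β‖ ^ 2 / g ^ 2 * g := by gcongr
      _ = ‖β‖ ^ 2 / g := by field_simp
  rw [h2, h3] at h1
  have h5 : ‖β‖ ^ 2 / g ≤ energy P⁻¹ y := by linarith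
  rwa [div_le_iff₀' hg] at h5

theorem energy_map_re (Q : Matrix (Fin n) (Fin n) ℂ) (y : Fin n → ℝ) :
    energy (Q.map Complex.re) y = energy Q (fun i => (y i : ℂ)) := by
  simp [energy, dotProduct, Matrix.mulVec, Finset.mul_sum]

/-- Converse of `energy_inv_conjTranspose_lt` over the reals. -/
theorem exists_energy_inv_add_lt {Q A : Matrix (Fin n) (Fin n) ℝ} {b : Fin n → ℝ}
    (hQ : Q.PosDef)
    (h : ∀ y ≠ 0, energy Q (Aᵀ *ᵥ y) < energy Q y + (y ⬝ᵥ b) ^ 2) {x : Fin n → ℝ} (hx : x ≠ 0) :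
    ∃ u : ℝ, energy Q⁻¹ (A *ᵥ x + u • b) + u ^ 2 < energy Q⁻¹ x := by
  have hu : IsUnit Q.det := (Matrix.isUnit_iff_isUnit_det _).1 hQ.isUnit
  have hS : (Q + Matrix.vecMulVec b b).PosDef := by
    refine posDef_iff_energy.2 ⟨hQ.isHermitian.add ?_, fun z hz => ?_⟩
    · rw [Matrix.IsHermitian, Matrix.conjTranspose_vecMulVec]
      simp
    · have := energy_vecMulVec b z
      rw [star_trivial] at this
      rw [energy_add, this]
      have := (posDef_iff_energy.1 hQ).2 z hz
      positivity
  have hSu : IsUnit (Q + Matrix.vecMulVec b b).det :=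
    (Matrix.isUnit_iff_isUnit_det _).1 hS.isUnit
  -- the optimal input is `u = -b y`, where `(Q + b bᵀ) y = A x`
  obtain ⟨y, hy⟩ : ∃ y, y = (Q + Matrix.vecMulVec b b)⁻¹ *ᵥ (A *ᵥ x) := ⟨_, rfl⟩
  have hSy : A *ᵥ x = Q *ᵥ y + (b ⬝ᵥ y) • b := by
    have : (Q + Matrix.vecMulVec b b) *ᵥ y = A *ᵥ x := by
      rw [hy, Matrix.mulVec_mulVec, Matrix.mul_nonsing_inv _ hSu, Matrix.one_mulVec]
    rw [← this, Matrix.add_mulVec, Matrix.vecMulVec_mulVec, op_smul_eq_smul]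
  refine ⟨-(b ⬝ᵥ y), ?_⟩
  have h1 : A *ᵥ x + (-(b ⬝ᵥ y)) • b = Q *ᵥ y := by
    rw [hSy, neg_smul, add_neg_cancel_right]
  have h2 : energy Q⁻¹ (Q *ᵥ y) = energy Q y := by
    rw [energy_real, energy_real, Matrix.mulVec_mulVec y Q⁻¹ Q, Matrix.nonsing_inv_mul _ hu,
      Matrix.one_mulVec, dotProduct_comm]
  rw [h1, h2]
  have hxpos : 0 < energy Q⁻¹ x := (posDef_iff_energy.1 hQ.inv).2 x hx
  rcases eq_or_ne y 0 with h0 | h0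
  · simpa [h0, energy_real] using hxpos
  have h3 := two_mul_re_dotProduct_le hQ.inv x (Aᵀ *ᵥ y)
  rw [Matrix.nonsing_inv_nonsing_inv _ hu] at h3
  have h4 : star (Aᵀ *ᵥ y) ⬝ᵥ x = energy Q y + (b ⬝ᵥ y) ^ 2 := by
    rw [star_trivial, Matrix.mulVec_transpose, ← Matrix.dotProduct_mulVec, hSy, dotProduct_add,
      ← energy_real, dotProduct_smul, dotProduct_comm y b, smul_eq_mul, sq]
  rw [h4, RCLike.re_to_real] at h3
  have h5 := h y h0
  rw [dotProduct_comm y b] at h5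
  linarith [neg_sq (b ⬝ᵥ y)]

/-- Real version of `exists_posDef_energy_add_lt` for `R = 1`: the form is the inverse of the real
part of the inverse of the complex one. -/
theorem exists_posDef_energy_add_lt_real {A : Matrix (Fin n) (Fin n) ℝ} {b : Fin n → ℝ}
    (hAb : IsHautus (toComplex A) (fun i => (b i : ℂ))) {g : ℝ}
    (hg : ((unstableRoots (toComplex A)).map fun z : ℂ => ‖z‖ ^ 2).prod < 1 + g) :
    ∃ P : Matrix (Fin n) (Fin n) ℝ, P.PosDef ∧
      (∀ x ≠ 0, ∃ u : ℝ, energy P (A *ᵥ x + u • b) + u ^ 2 < energy P x) ∧ energy P b ≤ g := by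
  obtain ⟨P, hP, hlt, hPb⟩ := exists_posDef_energy_add_lt hAb one_pos (by rwa [one_mul])
  have hg0 : 0 < g := by linarith [one_le_prod_unstableRoots (toComplex A)]
  have hQ : (P⁻¹.map Complex.re).PosDef := by
    refine posDef_iff_energy.2 ⟨?_, fun y hy => ?_⟩
    · ext i j
      have := congrArg Complex.re (hP.inv.isHermitian.apply i j)
      simpa using this
    · rw [energy_map_re]
      refine (posDef_iff_energy.1 hP.inv).2 _ fun h => hy ?_
      ext i
      simpa using congrFun h i
  have hu : IsUnit (P⁻¹.map Complex.re).det := (Matrix.isUnit_iff_isUnit_det _).1 hQ.isUnit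
  have hdot : ∀ y : Fin n → ℝ, ‖star (fun i => (y i : ℂ)) ⬝ᵥ (fun i => (b i : ℂ))‖ ^ 2 =
      (y ⬝ᵥ b) ^ 2 := fun y => by
    have : star (fun i => (y i : ℂ)) ⬝ᵥ (fun i => (b i : ℂ)) = ((y ⬝ᵥ b : ℝ) : ℂ) := by
      simp [dotProduct]
    rw [this, Complex.norm_real, Real.norm_eq_abs, sq_abs]
  refine ⟨(P⁻¹.map Complex.re)⁻¹, hQ.inv, fun x hx => exists_energy_inv_add_lt hQ ?_ hx, ?_⟩
  · intro y hy
    have hy' : (fun i => (y i : ℂ)) ≠ 0 := fun h => hy <| by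
      ext i
      simpa using congrFun h i
    have h := energy_inv_conjTranspose_lt hP (by simpa using hlt) hy'
    have hA : (toComplex A)ᴴ *ᵥ (fun i => (y i : ℂ)) = fun i => (((Aᵀ *ᵥ y) i : ℝ) : ℂ) := by
      ext i
      simp [toComplex, Matrix.mulVec, dotProduct]
    rwa [hA, hdot, ← energy_map_re, ← energy_map_re] at h
  · set y := (P⁻¹.map Complex.re)⁻¹ *ᵥ b with hy
    have h := norm_dotProduct_sq_le_mul_energy_inv hP hg0 (by linarith) (fun i => (y i : ℂ))
    have h1 : energy (P⁻¹.map Complex.re)⁻¹ b = y ⬝ᵥ b := by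
      rw [energy_real, dotProduct_comm]
    have h2 : energy (P⁻¹.map Complex.re) y = y ⬝ᵥ b := by
      rw [energy_real, hy, Matrix.mulVec_mulVec, Matrix.mul_nonsing_inv _ hu, Matrix.one_mulVec]
    rw [hdot, ← energy_map_re, h2] at h
    rw [h1]
    by_contra! hlt'
    nlinarith

end Descent

section Gain

variable {n : ℕ}

/-! ### The modified algebraic Riccati inequality -/

/-- Also valid if `Bᵀ P B = 0`, where both inverses are zero. -/
theorem mul_inv_mul_mulVec (P : Matrix (Fin n) (Fin n) ℝ) (B : Matrix (Fin n) (Fin 1) ℝ)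
    (x : Fin n → ℝ) :
    (B * ((Bᵀ * P * B)⁻¹ * Bᵀ)) *ᵥ x = ((energy P (B.col 0))⁻¹ * (B.col 0 ⬝ᵥ x)) • B.col 0 := by
  have h0 : (Bᵀ * P * B) 0 0 = energy P (B.col 0) := by
    rw [energy_real, Matrix.mul_apply, Matrix.dotProduct_mulVec]
    rfl
  have h : (Bᵀ * P * B)⁻¹ = (energy P (B.col 0))⁻¹ • (1 : Matrix (Fin 1) (Fin 1) ℝ) := by
    rw [Matrix.inv_subsingleton]
    ext i j
    rw [Subsingleton.elim i 0, Subsingleton.elim j 0]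
    simp [h0]
  ext i
  rw [h, Matrix.smul_mul, Matrix.one_mul, Matrix.mul_smul, Matrix.smul_mulVec,
    ← Matrix.mulVec_mulVec]
  have hB : ∀ y : Fin 1 → ℝ, (B *ᵥ y) i = B i 0 * y 0 := fun y => by
    simp [Matrix.mulVec, dotProduct]
  have hBt : (Bᵀ *ᵥ x) 0 = B.col 0 ⬝ᵥ x := rfl
  rw [Pi.smul_apply, hB, hBt]
  simp only [Pi.smul_apply, smul_eq_mul, Matrix.col_apply]
  ring

theorem riccatiIneq_iff {M P : Matrix (Fin n) (Fin n) ℝ} {B : Matrix (Fin n) (Fin 1) ℝ} {σ : ℝ}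
    (hP : P.IsHermitian) :
    RiccatiIneq M B σ P ↔ ∀ x ≠ 0, energy P (M *ᵥ x) -
      σ * ((B.col 0 ⬝ᵥ (P *ᵥ (M *ᵥ x))) ^ 2 / energy P (B.col 0)) < energy P x := by
  have hPt : Pᵀ = P := hP
  have hH : (-(Mᵀ * P * M - σ • (Mᵀ * P * B * (Bᵀ * P * B)⁻¹ * Bᵀ * P * M) - P)).IsHermitian := by
    simp [Matrix.IsHermitian, Matrix.conjTranspose_eq_transpose_of_trivial,
      hPt, Matrix.mul_assoc]
  have hE : ∀ x, energy (Mᵀ * P * B * (Bᵀ * P * B)⁻¹ * Bᵀ * P * M) x =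
      (B.col 0 ⬝ᵥ (P *ᵥ (M *ᵥ x))) ^ 2 / energy P (B.col 0) := fun x => by
    have h1 : Mᵀ * P * B * (Bᵀ * P * B)⁻¹ * Bᵀ * P * M =
        Mᵀ * (P * (B * ((Bᵀ * P * B)⁻¹ * Bᵀ) * (P * M))) := by
      simp only [Matrix.mul_assoc]
    have h2 : (M *ᵥ x) ⬝ᵥ (P *ᵥ B.col 0) = B.col 0 ⬝ᵥ (P *ᵥ (M *ᵥ x)) := by
      rw [dotProduct_comm, ← Matrix.vecMul_transpose, hPt, ← Matrix.dotProduct_mulVec]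
    rw [energy_real, h1, ← Matrix.mulVec_mulVec, Matrix.dotProduct_mulVec, Matrix.vecMul_transpose,
      ← Matrix.mulVec_mulVec, ← Matrix.mulVec_mulVec, mul_inv_mul_mulVec, Matrix.mulVec_smul,
      dotProduct_smul, h2, ← Matrix.mulVec_mulVec, smul_eq_mul]
    ring
  have hM : ∀ x, energy (Mᵀ * P * M) x = energy P (M *ᵥ x) := energy_conjTranspose_mul_mul P M
  have hneg : ∀ (X : Matrix (Fin n) (Fin n) ℝ) x, energy (-X) x = -energy X x := fun X x => by
    simp [energy_real, Matrix.neg_mulVec]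
  rw [RiccatiIneq, posDef_iff_energy, and_iff_right hH]
  refine forall₂_congr fun x _ => ?_
  rw [hneg, energy_sub, energy_sub, energy_smul, hM, hE]
  constructor <;> intro h <;> linarith

theorem RiccatiIneq.mono {M P : Matrix (Fin n) (Fin n) ℝ} {B : Matrix (Fin n) (Fin 1) ℝ}
    {σ τ : ℝ} (hP : P.PosDef) (h : RiccatiIneq M B σ P) (hστ : σ ≤ τ) : RiccatiIneq M B τ P := by
  rw [riccatiIneq_iff hP.isHermitian] at h ⊢
  intro x hx
  refine lt_of_le_of_lt ?_ (h x hx)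
  have := energy_nonneg hP (B.col 0)
  gcongr

theorem energy_add_smul {P : Matrix (Fin n) (Fin n) ℝ} (hP : P.IsHermitian) (x b : Fin n → ℝ)
    (u : ℝ) :
    energy P (x + u • b) = energy P x + 2 * u * (b ⬝ᵥ (P *ᵥ x)) + u ^ 2 * energy P b := by
  have hPt : Pᵀ = P := hP
  have h2 : x ⬝ᵥ (P *ᵥ b) = b ⬝ᵥ (P *ᵥ x) := by
    rw [dotProduct_comm, ← Matrix.vecMul_transpose, hPt, ← Matrix.dotProduct_mulVec]
  simp only [energy_real, Matrix.mulVec_add, Matrix.mulVec_smul, add_dotProduct, dotProduct_add,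
    smul_dotProduct, dotProduct_smul, h2, smul_eq_mul]
  ring

/-- The case distinction in `sigmaCrit` is redundant: the product is empty if the spectral radius is
less than one. -/
theorem sigmaCrit_eq (M : Matrix (Fin n) (Fin n) ℝ) :
    sigmaCrit M = 1 - 1 / ((unstableRoots (toComplex M)).map fun z : ℂ => ‖z‖ ^ 2).prod := by
  rw [sigmaCrit]
  split_ifs with h
  · rfl
  · have h0 : unstableRoots (toComplex M) = 0 := by
      refine Multiset.eq_zero_of_forall_notMem fun z hz => h ?_
      obtain ⟨hz, hz1⟩ := Multiset.mem_filter.1 hz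
      have hmem : z ∈ spectrum ℂ (toComplex M) := Matrix.mem_spectrum_iff_isRoot_charpoly.2
        ((Polynomial.mem_roots (Matrix.charpoly_monic _).ne_zero).1 hz)
      refine le_trans ?_ (le_iSup₂ (f := fun k (_ : k ∈ spectrum ℂ (toComplex M)) =>
        (‖k‖₊ : ENNReal)) z hmem)
      exact_mod_cast hz1
    simp [h0]

theorem exists_posDef_riccatiIneq {M : Matrix (Fin n) (Fin n) ℝ} {B : Matrix (Fin n) (Fin 1) ℝ}
    (hMB : IsHautus (toComplex M) (fun i => (B i 0 : ℂ))) {σ : ℝ} (hσ : sigmaCrit M < σ) :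
    ∃ P : Matrix (Fin n) (Fin n) ℝ, P.PosDef ∧ RiccatiIneq M B σ P := by
  rw [sigmaCrit_eq] at hσ
  have hq1 := one_le_prod_unstableRoots (toComplex M)
  set q := ((unstableRoots (toComplex M)).map fun z : ℂ => ‖z‖ ^ 2).prod
  -- `g / (1 + g) = σ` has no solution if `σ ≥ 1`; then every `g` will do
  obtain ⟨g, hg, hgσ⟩ : ∃ g : ℝ, q < 1 + g ∧ g / (1 + g) ≤ σ := by
    rcases lt_or_ge σ 1 with h1 | h1
    · have hs : 0 < 1 - σ := by linarith
      refine ⟨1 / (1 - σ) - 1, ?_, le_of_eq ?_⟩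
      · rw [add_sub_cancel, lt_div_iff₀ hs]
        rw [sub_lt_comm, lt_div_iff₀ (by linarith)] at hσ
        linarith
      · field_simp
        ring
    · refine ⟨q, by linarith, le_trans ?_ h1⟩
      rw [div_le_one (by linarith)]
      linarith
  have hg0 : 0 < g := by linarith
  obtain ⟨P, hP, hlt, hPb⟩ := exists_posDef_energy_add_lt_real (b := B.col 0) hMB hg
  refine ⟨P, hP, (riccatiIneq_iff hP.isHermitian).2 fun x hx => ?_⟩
  obtain ⟨u, hu⟩ := hlt x hx
  rw [energy_add_smul hP.isHermitian] at hu
  have hE := energy_nonneg hP (B.col 0)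
  set β := B.col 0 ⬝ᵥ (P *ᵥ (M *ᵥ x))
  set e := energy P (B.col 0) with he
  refine lt_of_le_of_lt ?_ hu
  rcases hE.eq_or_lt with h0 | h0
  · -- the form of `P` vanishes at the input vector only if the latter is zero
    have hb0 : B.col 0 = 0 := by
      by_contra hb
      exact ((posDef_iff_energy.1 hP).2 _ hb).ne (he ▸ h0)
    have hβ : β = 0 := by simp [β, hb0]
    rw [← h0, hβ]
    nlinarith [sq_nonneg u]
  · have h1 : β ^ 2 / (1 + e) ≤ σ * (β ^ 2 / e) := by
      have h2 : e / (1 + e) ≤ σ := by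
        refine le_trans ?_ hgσ
        rw [div_le_div_iff₀ (by linarith) (by linarith)]
        linarith
      calc β ^ 2 / (1 + e) = e / (1 + e) * (β ^ 2 / e) := by field_simp
        _ ≤ σ * (β ^ 2 / e) := by gcongr
    have h3 : 0 ≤ 2 * u * β + u ^ 2 * e + u ^ 2 + β ^ 2 / (1 + e) := by
      have : 2 * u * β + u ^ 2 * e + u ^ 2 + β ^ 2 / (1 + e) = (β + u * (1 + e)) ^ 2 / (1 + e) := by
        field_simp
        ring
      rw [this]
      positivity
    linarith

/-! ### Stability of the modes -/

theorem sq_apply_le_inv_mul_energy {W : Matrix (Fin n) (Fin n) ℝ} (hW : W.PosDef)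
    (x : Fin n → ℝ) (s : Fin n) : x s ^ 2 ≤ energy W⁻¹ (Pi.single s 1) * energy W x := by
  have h : ∀ t : ℝ, 0 ≤ energy W⁻¹ (Pi.single s 1) * (t * t) + (-2 * x s) * t + energy W x := by
    intro t
    have h1 := two_mul_re_dotProduct_le hW x (t • Pi.single s 1)
    have h2 : energy W⁻¹ (t • Pi.single s 1) = energy W⁻¹ (Pi.single s 1) * (t * t) := by
      simp only [energy_real, Matrix.mulVec_smul, dotProduct_smul, smul_dotProduct, smul_eq_mul]
      ring
    rw [h2, star_trivial, smul_dotProduct, single_one_dotProduct, smul_eq_mul, RCLike.re_to_real]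
      at h1
    linarith
  have := discrim_le_zero h
  rw [discrim] at this
  linarith

/-- The values of the form converge along a trajectory, so its decrements `W(z_t)` tend to zero;
as `W` is positive definite, so does `z_t`. -/
theorem tendsto_zero_of_energy_lt {P M : Matrix (Fin n) (Fin n) ℝ} (hP : P.PosDef)
    (hlt : ∀ x ≠ 0, energy P (M *ᵥ x) < energy P x) {z : ℕ → Fin n → ℝ}
    (hz : ∀ t, z (t + 1) = M *ᵥ z t) : Tendsto z atTop (𝓝 0) := by
  have hE : ∀ x, energy (P - Mᴴ * P * M) x = energy P x - energy P (M *ᵥ x) := fun x => by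
    rw [energy_sub, energy_conjTranspose_mul_mul]
  have hW : (P - Mᴴ * P * M).PosDef := by
    refine posDef_iff_energy.2 ⟨hP.isHermitian.sub
      (Matrix.isHermitian_conjTranspose_mul_mul M hP.isHermitian), fun x hx => ?_⟩
    rw [hE]
    exact sub_pos.2 (hlt x hx)
  have hanti : Antitone fun t => energy P (z t) := antitone_nat_of_succ_le fun t => by
    have := energy_nonneg hW (z t)
    rw [hE] at this
    rw [hz]
    linarith
  obtain ⟨v, hv⟩ : ∃ v, Tendsto (fun t => energy P (z t)) atTop (𝓝 v) :=
    ⟨_, tendsto_atTop_ciInf hanti ⟨0, by rintro _ ⟨t, rfl⟩; exact energy_nonneg hP _⟩⟩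
  have hdiff : Tendsto (fun t => energy (P - Mᴴ * P * M) (z t)) atTop (𝓝 0) := by
    have := hv.sub (hv.comp (tendsto_add_atTop_nat 1))
    rw [sub_self] at this
    refine this.congr fun t => ?_
    rw [hE, Function.comp, hz]
  rw [tendsto_pi_nhds]
  intro s
  have h1 := hdiff.const_mul (energy (P - Mᴴ * P * M)⁻¹ (Pi.single s 1))
  rw [mul_zero] at h1
  have h2 : Tendsto (fun t => z t s ^ 2) atTop (𝓝 0) :=
    squeeze_zero (fun t => sq_nonneg _) (fun t => sq_apply_le_inv_mul_energy hW (z t) s) h1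
  have h3 := h2.sqrt
  simp only [Real.sqrt_sq_eq_abs, Real.sqrt_zero] at h3
  exact (tendsto_zero_iff_abs_tendsto_zero _).2 h3

/-- Action of the closed-loop matrix of a mode with the Riccati gain. -/
theorem mode_mulVec (A P : Matrix (Fin n) (Fin n) ℝ) (B : Matrix (Fin n) (Fin 1) ℝ)
    (a l k : ℝ) (x : Fin n → ℝ) :
    (a • A + l • (B * riccatiGain A B k P)) *ᵥ x =
      a • (A *ᵥ x) + (-(l * k * ((energy P (B.col 0))⁻¹ * (B.col 0 ⬝ᵥ (P *ᵥ (A *ᵥ x)))))) •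
        B.col 0 := by
  have h : B * riccatiGain A B k P = -(k • (B * ((Bᵀ * P * B)⁻¹ * Bᵀ) * (P * A))) := by
    simp only [riccatiGain, Matrix.mul_neg, Matrix.mul_smul, Matrix.mul_assoc]
  rw [h, Matrix.add_mulVec, Matrix.smul_mulVec, Matrix.smul_mulVec, Matrix.neg_mulVec,
    Matrix.smul_mulVec, ← Matrix.mulVec_mulVec, mul_inv_mul_mulVec, ← Matrix.mulVec_mulVec]
  simp only [smul_neg, neg_smul, smul_smul]
  ring_nf

theorem energy_mode_lt {A P : Matrix (Fin n) (Fin n) ℝ} {B : Matrix (Fin n) (Fin 1) ℝ}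
    {c a l k σ : ℝ} (hP : P.PosDef) (h : RiccatiIneq (c • A) B σ P) (hac : a ^ 2 ≤ c ^ 2)
    (hσ : σ * c ^ 2 = 2 * a * l * k - l ^ 2 * k ^ 2) {x : Fin n → ℝ} (hx : x ≠ 0) :
    energy P ((a • A + l • (B * riccatiGain A B k P)) *ᵥ x) < energy P x := by
  have h1 := (riccatiIneq_iff hP.isHermitian).1 h x hx
  have hsm : ∀ (r : ℝ) (y : Fin n → ℝ), energy P (r • y) = r ^ 2 * energy P y := fun r y => by
    simp only [energy_real, Matrix.mulVec_smul, dotProduct_smul, smul_dotProduct, smul_eq_mul]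
    ring
  have hnn := energy_nonneg hP (A *ᵥ x)
  rw [mode_mulVec, energy_add_smul hP.isHermitian]
  simp only [Matrix.smul_mulVec, Matrix.mulVec_smul, dotProduct_smul, hsm, smul_eq_mul] at h1 ⊢
  set β := B.col 0 ⬝ᵥ (P *ᵥ (A *ᵥ x))
  set e := energy P (B.col 0)
  -- also valid for `e = 0`, where both sides vanish
  have he : e⁻¹ * e⁻¹ * e = e⁻¹ := by
    rcases eq_or_ne e 0 with h0 | h0
    · simp [h0]
    · field_simp
  have h2 : a ^ 2 * energy P (A *ᵥ x) + 2 * -(l * k * (e⁻¹ * β)) * (a * β) +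
      (-(l * k * (e⁻¹ * β))) ^ 2 * e =
      a ^ 2 * energy P (A *ᵥ x) - σ * ((c * β) ^ 2 / e) := by
    rw [div_eq_mul_inv]
    linear_combination (l * k * β) ^ 2 * he + β ^ 2 * e⁻¹ * hσ
  rw [h2]
  nlinarith

end Gain

/-! ### Weighted Laplacians -/

namespace WeightedGraph

variable {V : Type*} [Fintype V] [DecidableEq V] (G : WeightedGraph V)

theorem laplacian_isHermitian : G.laplacian.IsHermitian := by
  refine (Matrix.isHermitian_diagonal _).sub ?_
  ext i j
  exact G.symm j i

theorem laplacian_mulVec (v : V → ℝ) (i : V) :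
    (G.laplacian *ᵥ v) i = ∑ j, G.weight i j * (v i - v j) := by
  rw [laplacian, Matrix.sub_mulVec, Pi.sub_apply, Matrix.mulVec_diagonal, Finset.sum_mul]
  simp [Matrix.mulVec, dotProduct, mul_sub]

theorem one_vecMul_laplacian : (1 : V → ℝ) ᵥ* G.laplacian = 0 := by
  have h : G.laplacianᵀ = G.laplacian := G.laplacian_isHermitian
  rw [← h, Matrix.vecMul_transpose]
  ext i
  simp [laplacian_mulVec]

theorem two_mul_energy_laplacian (v : V → ℝ) :
    2 * energy G.laplacian v = ∑ i, ∑ j, G.weight i j * (v i - v j) ^ 2 := by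
  have h1 : energy G.laplacian v = ∑ i, ∑ j, G.weight i j * (v i * (v i - v j)) := by
    rw [energy_real]
    simp only [dotProduct, laplacian_mulVec, Finset.mul_sum]
    exact Finset.sum_congr rfl fun i _ => Finset.sum_congr rfl fun j _ => by ring
  have h2 : energy G.laplacian v = ∑ i, ∑ j, G.weight i j * (v j * (v j - v i)) := by
    rw [h1, Finset.sum_comm]
    exact Finset.sum_congr rfl fun i _ => Finset.sum_congr rfl fun j _ => by rw [G.symm]
  rw [two_mul]
  nth_rewrite 1 [h1]
  rw [h2, ← Finset.sum_add_distrib]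
  refine Finset.sum_congr rfl fun i _ => ?_
  rw [← Finset.sum_add_distrib]
  exact Finset.sum_congr rfl fun j _ => by ring

theorem energy_laplacian_nonneg (v : V → ℝ) : 0 ≤ energy G.laplacian v := by
  have := G.two_mul_energy_laplacian v
  have h : 0 ≤ ∑ i, ∑ j, G.weight i j * (v i - v j) ^ 2 :=
    Finset.sum_nonneg fun i _ => Finset.sum_nonneg fun j _ =>
      mul_nonneg (G.nonneg i j) (sq_nonneg _)
  linarith

variable {G} in
theorem eq_of_energy_laplacian_eq_zero (hG : G.toSimpleGraph.Connected) {v : V → ℝ}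
    (hv : energy G.laplacian v = 0) (i j : V) : v i = v j := by
  have hnn : ∀ i j, 0 ≤ G.weight i j * (v i - v j) ^ 2 := fun i j =>
    mul_nonneg (G.nonneg i j) (sq_nonneg _)
  have hsum := G.two_mul_energy_laplacian v
  rw [hv, mul_zero, eq_comm,
    Finset.sum_eq_zero_iff_of_nonneg fun i _ => Finset.sum_nonneg fun j _ => hnn i j] at hsum
  have hadj : ∀ i j, G.toSimpleGraph.Adj i j → v i = v j := fun i j hij => by
    have h := (Finset.sum_eq_zero_iff_of_nonneg fun j _ => hnn i j).1
      (hsum i (Finset.mem_univ i)) j (Finset.mem_univ j)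
    have hw : G.weight i j ≠ 0 := ne_of_gt hij
    have h' := (mul_eq_zero.1 h).resolve_left hw
    exact sub_eq_zero.1 (pow_eq_zero_iff two_ne_zero |>.1 h')
  obtain ⟨p⟩ := hG.preconnected i j
  induction p with
  | nil => rfl
  | cons h _ ih => exact (hadj _ _ h).trans ih

end WeightedGraph

/-! ### Modal bases -/

/-- Two commuting real symmetric matrices have a common orthonormal eigenbasis. -/
theorem exists_orthogonal_mul_eq_mul_diagonal {N : ℕ} {S T : Matrix (Fin N) (Fin N) ℝ}
    (hS : S.IsHermitian) (hT : T.IsHermitian) (hST : Commute S T) :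
    ∃ (Φ : Matrix (Fin N) (Fin N) ℝ) (s t : Fin N → ℝ), Φᵀ * Φ = 1 ∧
      S * Φ = Φ * Matrix.diagonal s ∧ T * Φ = Φ * Matrix.diagonal t := by
  classical
  have hS' := Matrix.isSymmetric_toEuclideanLin_iff.2 hS
  have hT' := Matrix.isSymmetric_toEuclideanLin_iff.2 hT
  have hcomm : Commute (Matrix.toEuclideanLin S) (Matrix.toEuclideanLin T) := by
    refine LinearMap.ext fun x => ?_
    simp [Module.End.mul_apply, Matrix.toLpLin_apply, Matrix.mulVec_mulVec, hST.eq]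
  set V : ℝ × ℝ → Submodule ℝ (EuclideanSpace ℝ (Fin N)) := fun i =>
    Module.End.eigenspace (Matrix.toEuclideanLin S) i.2 ⊓
      Module.End.eigenspace (Matrix.toEuclideanLin T) i.1 with hV
  have hint := LinearMap.IsSymmetric.directSum_isInternal_of_commute hS' hT' hcomm
  have horth := LinearMap.IsSymmetric.orthogonalFamily_eigenspace_inf_eigenspace hS' hT'
  -- discard the zero summands, to have a finite index type
  have hfin : Finite {i // V i ≠ ⊥} :=
    (WellFoundedGT.finite_ne_bot_of_iSupIndep hint.submodule_iSupIndep).to_subtype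
  have := Fintype.ofFinite {i // V i ≠ ⊥}
  have hint' := DirectSum.isInternal_ne_bot_iff.2 hint
  have horth' : OrthogonalFamily ℝ (fun i : {i // V i ≠ ⊥} => V i) fun i => (V i).subtypeₗᵢ :=
    horth.comp Subtype.val_injective
  have hrank : Module.finrank ℝ (EuclideanSpace ℝ (Fin N)) = N := by simp
  set b := hint'.subordinateOrthonormalBasis hrank horth' with hb
  have hmem : ∀ i, ∃ p : ℝ × ℝ, b i ∈ V p := fun i =>
    ⟨_, hint'.subordinateOrthonormalBasis_subordinate hrank i horth'⟩
  choose p hp using hmem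
  refine ⟨Matrix.of fun a i => b i a, fun i => (p i).2, fun i => (p i).1, ?_, ?_, ?_⟩
  · ext i j
    have := b.inner_eq_ite i j
    rw [EuclideanSpace.inner_eq_star_dotProduct, star_trivial, dotProduct_comm] at this
    rw [Matrix.one_apply, ← this]
    rfl
  · ext a i
    have h := congrArg (fun y : EuclideanSpace ℝ (Fin N) => y a)
      (Module.End.mem_eigenspace_iff.1 (hp i).1)
    rw [Matrix.mul_diagonal, mul_comm]
    exact h
  · ext a i
    have h := congrArg (fun y : EuclideanSpace ℝ (Fin N) => y a)
      (Module.End.mem_eigenspace_iff.1 (hp i).2)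
    rw [Matrix.mul_diagonal, mul_comm]
    exact h

/-- A common eigenbasis contains a kernel vector of the Laplacian of the connected graph, which is
constant; it is moved to the first place and its sign is corrected. -/
theorem exists_isModalBasis {N : ℕ} [NeZero N] {Gp Gc : WeightedGraph (Fin N)}
    (hGc : Gc.toSimpleGraph.Connected) (hcomm : Commute Gp.laplacian Gc.laplacian) :
    ∃ (Φ : Matrix (Fin N) (Fin N) ℝ) (lamP lamC : Fin N → ℝ),
      IsModalBasis Gp.laplacian Gc.laplacian Φ lamP lamC := by
  obtain ⟨Φ, s, t, horth, hs, ht⟩ := exists_orthogonal_mul_eq_mul_diagonal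
    Gp.laplacian_isHermitian Gc.laplacian_isHermitian hcomm
  have horth' : Φ * Φᵀ = 1 := mul_eq_one_comm.1 horth
  have hN : (0 : ℝ) < N := Nat.cast_pos.2 (NeZero.pos N)
  have hcol : ∀ i j, ∑ a, Φ a i * Φ a j = if i = j then 1 else 0 := fun i j => by
    rw [← Matrix.one_apply, ← horth]
    rfl
  -- otherwise every column is orthogonal to the all-ones vector
  obtain ⟨i₀, hi₀⟩ : ∃ i, t i = 0 := by
    by_contra! hne
    have h1 : ((1 : Fin N → ℝ) ᵥ* Φ) ᵥ* Matrix.diagonal t = 0 := by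
      rw [Matrix.vecMul_vecMul, ← ht, ← Matrix.vecMul_vecMul, Gc.one_vecMul_laplacian,
        Matrix.zero_vecMul]
    have h2 : (1 : Fin N → ℝ) ᵥ* Φ = 0 := by
      ext i
      have := congrFun h1 i
      rw [Matrix.vecMul_diagonal] at this
      exact (mul_eq_zero.1 this).resolve_right (hne i)
    have h3 : (1 : Fin N → ℝ) = 0 := by
      rw [← Matrix.vecMul_one (1 : Fin N → ℝ), ← horth', ← Matrix.vecMul_vecMul, h2,
        Matrix.zero_vecMul]
    simpa using congrFun h3 0
  have hconst : ∀ a, Φ a i₀ = Φ 0 i₀ := fun a => by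
    refine WeightedGraph.eq_of_energy_laplacian_eq_zero hGc (v := fun a => Φ a i₀) ?_ a 0
    have h0 : Gc.laplacian *ᵥ (fun a => Φ a i₀) = 0 := by
      ext a
      have := congrFun (congrFun ht a) i₀
      rw [Matrix.mul_diagonal, hi₀, mul_zero] at this
      exact this
    rw [energy_real, h0, dotProduct_zero]
  have hκ : N * Φ 0 i₀ ^ 2 = 1 := by
    have := hcol i₀ i₀
    simp only [hconst] at this
    simpa [sq] using this
  set σ := Equiv.swap 0 i₀
  -- `√N * Φ 0 i₀ = ±1` corrects the sign of the constant column
  set ε : Fin N → ℝ := fun i => if i = 0 then Real.sqrt N * Φ 0 i₀ else 1 with hε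
  have hε2 : ∀ i, ε i * ε i = 1 := fun i => by
    by_cases hi : i = 0
    · simp only [hε, if_pos hi]
      have := Real.mul_self_sqrt hN.le
      linear_combination Φ 0 i₀ ^ 2 * this + hκ
    · simp [hε, hi]
  set Ψ : Matrix (Fin N) (Fin N) ℝ := Matrix.of fun a i => ε i * Φ a (σ i) with hΨ
  have hΨo : Ψᵀ * Ψ = 1 := by
    ext i j
    have h1 : (Ψᵀ * Ψ) i j = ε i * ε j * ∑ a, Φ a (σ i) * Φ a (σ j) := by
      rw [Matrix.mul_apply, Finset.mul_sum]
      exact Finset.sum_congr rfl fun a _ => by simp [hΨ]; ring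
    rw [h1, hcol, Matrix.one_apply]
    by_cases hij : i = j
    · subst hij
      simp [hε2]
    · simp [hij]
  have hdiag : ∀ (L : Matrix (Fin N) (Fin N) ℝ) (r : Fin N → ℝ), L * Φ = Φ * Matrix.diagonal r →
      Ψᵀ * L * Ψ = Matrix.diagonal fun i => r (σ i) := fun L r hL => by
    have h1 : L * Ψ = Ψ * Matrix.diagonal fun i => r (σ i) := by
      ext a i
      have h2 := congrFun (congrFun hL a) (σ i)
      rw [Matrix.mul_diagonal] at h2 ⊢
      have h3 : (L * Ψ) a i = ε i * (L * Φ) a (σ i) := by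
        rw [Matrix.mul_apply, Matrix.mul_apply, Finset.mul_sum]
        exact Finset.sum_congr rfl fun c _ => by simp [hΨ]; ring
      rw [h3, h2, hΨ, Matrix.of_apply]
      ring
    rw [Matrix.mul_assoc, h1, ← Matrix.mul_assoc, hΨo, Matrix.one_mul]
  refine ⟨Ψ, fun i => s (σ i), fun i => t (σ i), hΨo, fun a => ?_, hdiag _ _ hs, hdiag _ _ ht⟩
  have hsq := Real.mul_self_sqrt hN.le
  have hs0 : Real.sqrt N ≠ 0 := (Real.sqrt_pos.2 hN).ne'
  simp only [hΨ, hε, Matrix.of_apply, if_true, σ, Equiv.swap_apply_left, hconst a]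
  rw [eq_div_iff hs0]
  linear_combination Φ 0 i₀ ^ 2 * hsq + hκ

section Modes

variable {N n : ℕ} {Lp Lc Φ : Matrix (Fin N) (Fin N) ℝ} {lamP lamC : Fin N → ℝ}

theorem vecMul_of_conj_eq_diagonal {L : Matrix (Fin N) (Fin N) ℝ} {r : Fin N → ℝ}
    (hΦ : Φᵀ * Φ = 1) (h : Φᵀ * L * Φ = Matrix.diagonal r) (i : Fin N) :
    Φ.col i ᵥ* L = r i • Φ.col i := by
  have h1 : Φᵀ * L = Matrix.diagonal r * Φᵀ := by
    rw [← h, Matrix.mul_assoc _ Φ, mul_eq_one_comm.1 hΦ, Matrix.mul_one]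
  ext a
  have := congrFun (congrFun h1 i) a
  rw [Matrix.diagonal_mul] at this
  exact this

/-- The component `∑ a, φ a • x_a` of the joint state `x` along `φ`, a vector in the state space of
a single subsystem. -/
noncomputable def modal (φ : Fin N → ℝ) (x : Fin N × Fin n → ℝ) : Fin n → ℝ := fun s => ∑ a, φ a * x (a, s)

theorem modal_kronecker_mulVec (φ : Fin N → ℝ) (L : Matrix (Fin N) (Fin N) ℝ)
    (M : Matrix (Fin n) (Fin n) ℝ) (x : Fin N × Fin n → ℝ) :
    modal φ ((L ⊗ₖ M) *ᵥ x) = M *ᵥ modal (φ ᵥ* L) x := by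
  ext s
  simp only [modal, Matrix.mulVec, Matrix.vecMul, dotProduct, Fintype.sum_prod_type,
    Matrix.kroneckerMap_apply, Finset.mul_sum, Finset.sum_mul]
  rw [Finset.sum_comm, Finset.sum_comm (s := Finset.univ (α := Fin n))]
  refine Finset.sum_congr rfl fun b _ => ?_
  rw [Finset.sum_comm]
  exact Finset.sum_congr rfl fun r _ => Finset.sum_congr rfl fun a _ => by ring

variable [NeZero N]

/-- A column other than the first is orthogonal to the constants, hence not in the kernel of the
Laplacian of a connected graph. -/
theorem IsModalBasis.lamC_pos {Gp Gc : WeightedGraph (Fin N)}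
    (h : IsModalBasis Gp.laplacian Gc.laplacian Φ lamP lamC)
    (hGc : Gc.toSimpleGraph.Connected) (i : Mode N) : 0 < lamC i := by
  have hcol : ∀ i j, Φ.col i ⬝ᵥ Φ.col j = if i = j then 1 else 0 := fun i j => by
    rw [← Matrix.one_apply, ← h.orthogonal]
    rfl
  have hE : energy Gc.laplacian (Φ.col i) = lamC i := by
    rw [energy_real, Matrix.dotProduct_mulVec, vecMul_of_conj_eq_diagonal h.orthogonal h.diag_c,
      smul_dotProduct, hcol, if_pos rfl, smul_eq_mul, mul_one]
  refine lt_of_le_of_ne (hE ▸ Gc.energy_laplacian_nonneg _) fun h0 => ?_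
  have hconst := WeightedGraph.eq_of_energy_laplacian_eq_zero hGc (hE.trans h0.symm)
  have hN : (0 : ℝ) < N := Nat.cast_pos.2 (NeZero.pos N)
  have h2 := hcol 0 i
  rw [if_neg i.2.symm] at h2
  have h3 : Φ.col 0 ⬝ᵥ Φ.col i = N * (1 / Real.sqrt N * Φ.col i 0) := by
    simp only [dotProduct, hconst _ 0]
    simp [Matrix.col, h.first_col]
  have h4 : Φ.col i 0 = 0 := by
    rw [h3] at h2
    have : Real.sqrt N ≠ 0 := (Real.sqrt_pos.2 hN).ne'
    simpa [hN.ne', this] using h2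
  have h5 := hcol i i
  rw [if_pos rfl] at h5
  simp only [dotProduct, hconst _ 0, h4, mul_zero, Finset.sum_const_zero, zero_ne_one] at h5

theorem modal_closedLoop (h : IsModalBasis Lp Lc Φ lamP lamC) (A Ap : Matrix (Fin n) (Fin n) ℝ)
    (B : Matrix (Fin n) (Fin 1) ℝ) (K : Matrix (Fin 1) (Fin n) ℝ) (x : Fin N × Fin n → ℝ)
    (i : Fin N) :
    modal (Φ.col i) (closedLoop Lp Lc A Ap B K *ᵥ x) =
      (A - lamP i • Ap + lamC i • (B * K)) *ᵥ modal (Φ.col i) x := by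
  have hadd : ∀ y z : Fin N × Fin n → ℝ, modal (Φ.col i) (y + z) =
      modal (Φ.col i) y + modal (Φ.col i) z := fun y z => by
    ext s
    simp [modal, mul_add, Finset.sum_add_distrib]
  have hsub : ∀ y z : Fin N × Fin n → ℝ, modal (Φ.col i) (y - z) =
      modal (Φ.col i) y - modal (Φ.col i) z := fun y z => by
    ext s
    simp [modal, mul_sub, Finset.sum_sub_distrib]
  have hsmul : ∀ r : ℝ, modal (r • Φ.col i) x = r • modal (Φ.col i) x := fun r => by
    ext s
    simp [modal, Finset.mul_sum, mul_assoc]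
  rw [closedLoop, Matrix.add_mulVec, Matrix.sub_mulVec, hadd, hsub, modal_kronecker_mulVec,
    modal_kronecker_mulVec, modal_kronecker_mulVec, Matrix.vecMul_one,
    vecMul_of_conj_eq_diagonal h.orthogonal h.diag_p,
    vecMul_of_conj_eq_diagonal h.orthogonal h.diag_c, hsmul, hsmul, Matrix.add_mulVec,
    Matrix.sub_mulVec, Matrix.smul_mulVec, Matrix.smul_mulVec, Matrix.mulVec_smul,
    Matrix.mulVec_smul]

theorem sub_average_eq_sum_modal (h : IsModalBasis Lp Lc Φ lamP lamC) (x : Fin N × Fin n → ℝ)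
    (a : Fin N) :
    (fun s => x (a, s)) - average x =
      ∑ i ∈ Finset.univ.erase 0, Φ a i • modal (Φ.col i) x := by
  ext s
  have h1 : x (a, s) = ∑ i, Φ a i * modal (Φ.col i) x s := by
    have h2 : Φ *ᵥ (Φᵀ *ᵥ fun c => x (c, s)) = fun c => x (c, s) := by
      rw [Matrix.mulVec_mulVec, mul_eq_one_comm.1 h.orthogonal, Matrix.one_mulVec]
    exact (congrFun h2 a).symm
  have h0 : average x s = Φ a 0 * modal (Φ.col 0) x s := by
    have hN : (N : ℝ) = Real.sqrt N * Real.sqrt N :=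
      (Real.mul_self_sqrt (Nat.cast_nonneg N)).symm
    simp only [average, modal, Matrix.col, Matrix.transpose_apply, h.first_col, ← Finset.mul_sum]
    rw [← mul_assoc, div_mul_div_comm, ← hN, one_mul]
  rw [Pi.sub_apply, h0, h1, ← Finset.add_sum_erase _ _ (Finset.mem_univ 0), add_sub_cancel_left]
  simp

theorem achievesConsensus_of_tendsto_modes (h : IsModalBasis Lp Lc Φ lamP lamC)
    {A Ap : Matrix (Fin n) (Fin n) ℝ} {B : Matrix (Fin n) (Fin 1) ℝ}
    {K : Matrix (Fin 1) (Fin n) ℝ}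
    (hK : ∀ (i : Mode N) (z : ℕ → Fin n → ℝ),
      (∀ t, z (t + 1) = (A - lamP i • Ap + lamC i • (B * K)) *ᵥ z t) → Tendsto z atTop (𝓝 0)) :
    AchievesConsensus Lp Lc A Ap B K := by
  intro x hx a
  have h1 : Tendsto (fun t => ∑ i ∈ Finset.univ.erase 0, Φ a i • modal (Φ.col i) (x t)) atTop
      (𝓝 (∑ i ∈ Finset.univ.erase (0 : Fin N), Φ a i • (0 : Fin n → ℝ))) :=
    tendsto_finsetSum _ fun i hi => (hK ⟨i, Finset.ne_of_mem_erase hi⟩ _ fun t => by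
      rw [hx, modal_closedLoop h]).const_smul _
  simp only [smul_zero, Finset.sum_const_zero] at h1
  exact h1.congr fun t => (sub_average_eq_sum_modal h (x t) a).symm

end Modes

/-! ### Controllability and the gain margin -/

/-- If `w A = l w` and `w B = 0`, then `w x` remains zero along every trajectory from the origin. -/
theorem IsControllable.isHautus {n : ℕ} {A : Matrix (Fin n) (Fin n) ℝ}
    {B : Matrix (Fin n) (Fin 1) ℝ} (h : IsControllable A B) :
    IsHautus (toComplex A) (fun i => (B i 0 : ℂ)) := by
  intro w l hw hwA hwB
  refine hw (funext fun s => ?_)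
  obtain ⟨T, u, x, hx0, hx, hxT⟩ := h 0 (Pi.single s 1)
  have hzero : ∀ t, w ⬝ᵥ (fun i => (x t i : ℂ)) = 0 := by
    intro t
    induction t with
    | zero => simp [hx0]
    | succ t ih =>
      have h1 : (fun i => (x (t + 1) i : ℂ)) = toComplex A *ᵥ (fun i => (x t i : ℂ)) +
          (u t 0 : ℂ) • fun i => (B i 0 : ℂ) := by
        ext i
        simp [hx, toComplex, Matrix.mulVec, dotProduct, mul_comm]
      rw [h1, dotProduct_add, Matrix.dotProduct_mulVec, hwA, smul_dotProduct, ih,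
        dotProduct_smul, hwB]
      simp
  have h2 := hzero T
  have h3 : (fun i => (x T i : ℂ)) = Pi.single s 1 := by
    ext i
    rw [hxT, Pi.single_apply, Pi.single_apply]
    split_ifs <;> simp
  rwa [h3, dotProduct_single_one] at h2

theorem isHautus_of_smul {n : ℕ} {A : Matrix (Fin n) (Fin n) ℝ} {b : Fin n → ℂ} {a c : ℝ}
    (h : IsHautus (toComplex (a • A)) b) (hc : c ≠ 0) : IsHautus (toComplex (c • A)) b := by
  intro w l hw hwA
  refine h w (a / c * l) hw ?_
  have hm : ∀ r : ℝ, toComplex (r • A) = (r : ℂ) • toComplex A := fun r => by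
    ext i j
    simp [toComplex]
  have hc' : (c : ℂ) ≠ 0 := by exact_mod_cast hc
  rw [hm, Matrix.vecMul_smul] at hwA ⊢
  rw [mul_smul, ← hwA, smul_smul, div_mul_cancel₀ _ hc']

section Margin

variable {N : ℕ} [NeZero N] {α : ℝ} {lamP lamC : Fin N → ℝ}

theorem abs_alphaMode_le_alphaMax (i : Mode N) : |alphaMode α lamP i| ≤ alphaMax α lamP :=
  le_ciSup (f := fun i : Mode N => |alphaMode α lamP i|) (Set.finite_range _).bddAbove i

theorem alphaMin_le_abs_alphaMode (i : Mode N) : alphaMin α lamP ≤ |alphaMode α lamP i| :=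
  ciInf_le (f := fun i : Mode N => |alphaMode α lamP i|) (Set.finite_range _).bddBelow i

theorem alphaMin_nonneg : 0 ≤ alphaMin α lamP := Real.iInf_nonneg fun _ => abs_nonneg _

/-- If `α_max = 0`, then `α_min = 0` and the right-hand side of the gap condition vanishes. -/
theorem alphaMax_pos_of_lt {σ : ℝ} (i : Mode N)
    (h : ((ratioMax α lamP lamC - ratioMin α lamP lamC) / 2) ^ 2 <
      (alphaMin α lamP ^ 2 - alphaMax α lamP ^ 2 * σ) / lamMax lamC ^ 2) :
    0 < alphaMax α lamP := by
  have h1 : 0 ≤ alphaMax α lamP := (abs_nonneg _).trans (abs_alphaMode_le_alphaMax i)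
  refine lt_of_le_of_ne h1 fun h0 => ?_
  have h2 : alphaMin α lamP = 0 := le_antisymm
    (((alphaMin_le_abs_alphaMode i).trans (abs_alphaMode_le_alphaMax i)).trans h0.ge)
    alphaMin_nonneg
  rw [← h0, h2] at h
  norm_num at h
  exact absurd h (sq_nonneg _).not_gt

/-- The gap condition bounds all `σ_i` from below, since
`α_max² σ_i = α_i² - λ_{c,i}² (α_i / λ_{c,i} - k)²` and `k` is the midpoint of the extreme ratios. -/
theorem lt_sigmaMode {σ : ℝ} (hlam : ∀ i : Mode N, 0 < lamC i)
    (h : ((ratioMax α lamP lamC - ratioMin α lamP lamC) / 2) ^ 2 <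
      (alphaMin α lamP ^ 2 - alphaMax α lamP ^ 2 * σ) / lamMax lamC ^ 2) (i : Mode N) :
    σ < sigmaMode α lamP lamC i := by
  have hpos := alphaMax_pos_of_lt i h
  have hl := hlam i
  have hlm : lamC i ≤ lamMax lamC :=
    le_ciSup (f := fun j : Mode N => lamC j) (Set.finite_range _).bddAbove i
  have hmax : alphaMode α lamP i / lamC i ≤ ratioMax α lamP lamC :=
    le_ciSup (f := fun p : Mode N × Mode N => alphaMode α lamP p.1 / lamC p.2)
      (Set.finite_range _).bddAbove (i, i)
  have hmin : ratioMin α lamP lamC ≤ alphaMode α lamP i / lamC i :=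
    ciInf_le (f := fun p : Mode N × Mode N => alphaMode α lamP p.1 / lamC p.2)
      (Set.finite_range _).bddBelow (i, i)
  rw [lt_div_iff₀ (by nlinarith : 0 < lamMax lamC ^ 2)] at h
  rw [sigmaMode, lt_div_iff₀ (by positivity)]
  set a := alphaMode α lamP i with ha
  set k := gainScalar α lamP lamC with hk
  set d := (ratioMax α lamP lamC - ratioMin α lamP lamC) / 2 with hd
  have h1 : (a / lamC i - k) ^ 2 ≤ d ^ 2 := by
    refine sq_le_sq' ?_ ?_ <;> rw [hk, hd, gainScalar] <;> linarith
  have h2 : (a - lamC i * k) ^ 2 ≤ d ^ 2 * lamMax lamC ^ 2 := by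
    calc (a - lamC i * k) ^ 2 = (a / lamC i - k) ^ 2 * lamC i ^ 2 := by field_simp
      _ ≤ d ^ 2 * lamMax lamC ^ 2 := by gcongr
  have h3 : alphaMin α lamP ^ 2 ≤ a ^ 2 := by
    rw [← sq_abs a]
    exact pow_le_pow_left₀ alphaMin_nonneg (alphaMin_le_abs_alphaMode i) 2
  linarith

end Margin

end LIMAS

theorem proposition1 (N n : ℕ) [NeZero N] (hN : 2 ≤ N)
    (Gp Gc : LIMAS.WeightedGraph (Fin N)) (hGc : Gc.toSimpleGraph.Connected)
    (A Ap : Matrix (Fin n) (Fin n) ℝ) (B : Matrix (Fin n) (Fin 1) ℝ)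
    (hcomm : Commute Gp.laplacian Gc.laplacian)
    (α : ℝ) (hAp : Ap = α • A) :
    (∃ (Φ : Matrix (Fin N) (Fin N) ℝ) (lamP lamC : Fin N → ℝ),
      LIMAS.IsModalBasis Gp.laplacian Gc.laplacian Φ lamP lamC) ∧
    ∀ (Φ : Matrix (Fin N) (Fin N) ℝ) (lamP lamC : Fin N → ℝ),
      LIMAS.IsModalBasis Gp.laplacian Gc.laplacian Φ lamP lamC →
      (∀ i : LIMAS.Mode N, LIMAS.IsControllable (A - lamP i • Ap) B) →
      ((LIMAS.ratioMax α lamP lamC - LIMAS.ratioMin α lamP lamC) / 2) ^ 2 <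
        (LIMAS.alphaMin α lamP ^ 2 -
          LIMAS.alphaMax α lamP ^ 2 * LIMAS.sigmaCrit (LIMAS.alphaMax α lamP • A)) /
          LIMAS.lamMax lamC ^ 2 →
      LIMAS.Consensusable Gp.laplacian Gc.laplacian A Ap B ∧
      (∃ P : Matrix (Fin n) (Fin n) ℝ, P.PosDef ∧
        ∀ i : LIMAS.Mode N, LIMAS.RiccatiIneq (LIMAS.alphaMax α lamP • A) B
          (LIMAS.sigmaMode α lamP lamC i) P) ∧
      (∀ P : Matrix (Fin n) (Fin n) ℝ, P.PosDef →
        (∀ i : LIMAS.Mode N, LIMAS.RiccatiIneq (LIMAS.alphaMax α lamP • A) B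
          (LIMAS.sigmaMode α lamP lamC i) P) →
        LIMAS.AchievesConsensus Gp.laplacian Gc.laplacian A Ap B
          (LIMAS.riccatiGain A B (LIMAS.gainScalar α lamP lamC) P)) := by
  refine ⟨LIMAS.exists_isModalBasis hGc hcomm, fun Φ lamP lamC hΦ hctrl hgap => ?_⟩
  have hmode : ∀ i : LIMAS.Mode N, A - lamP i • Ap = LIMAS.alphaMode α lamP i • A := fun i => by
    rw [hAp, smul_smul, LIMAS.alphaMode, sub_smul, one_smul, mul_comm]
  let i₁ : LIMAS.Mode N := ⟨⟨1, hN⟩, fun h => one_ne_zero (congrArg Fin.val h)⟩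
  have : Nonempty (LIMAS.Mode N) := ⟨i₁⟩
  have hpos := LIMAS.alphaMax_pos_of_lt i₁ hgap
  have hgain : ∀ P : Matrix (Fin n) (Fin n) ℝ, P.PosDef →
      (∀ i : LIMAS.Mode N, LIMAS.RiccatiIneq (LIMAS.alphaMax α lamP • A) B
        (LIMAS.sigmaMode α lamP lamC i) P) →
      LIMAS.AchievesConsensus Gp.laplacian Gc.laplacian A Ap B
        (LIMAS.riccatiGain A B (LIMAS.gainScalar α lamP lamC) P) := by
    intro P hP hric
    refine LIMAS.achievesConsensus_of_tendsto_modes hΦ fun i z hz => ?_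
    simp only [hmode] at hz
    refine LIMAS.tendsto_zero_of_energy_lt hP (fun x hx => ?_) hz
    refine LIMAS.energy_mode_lt hP (hric i) ?_ ?_ hx
    · rw [← sq_abs (LIMAS.alphaMode α lamP i)]
      exact pow_le_pow_left₀ (abs_nonneg _) (LIMAS.abs_alphaMode_le_alphaMax i) 2
    · rw [LIMAS.sigmaMode, div_mul_cancel₀ _ (by positivity)]
  obtain ⟨P, hP, hric⟩ : ∃ P : Matrix (Fin n) (Fin n) ℝ, P.PosDef ∧
      ∀ i : LIMAS.Mode N, LIMAS.RiccatiIneq (LIMAS.alphaMax α lamP • A) B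
        (LIMAS.sigmaMode α lamP lamC i) P := by
    -- the inequality is weakest for large `σ`, so only the smallest `σ_i` matters
    obtain ⟨i₀, hi₀⟩ := Finite.exists_min (LIMAS.sigmaMode α lamP lamC)
    have hH := LIMAS.isHautus_of_smul (hmode i₁ ▸ hctrl i₁).isHautus hpos.ne'
    obtain ⟨P, hP, hric⟩ := LIMAS.exists_posDef_riccatiIneq hH
      (LIMAS.lt_sigmaMode (hΦ.lamC_pos hGc) hgap i₀)
    exact ⟨P, hP, fun i => hric.mono hP (hi₀ i)⟩
  exact ⟨⟨_, hgain P hP hric⟩, ⟨P, hP, hric⟩, hgain⟩
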